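/- Let $\mathbf H(\mathbb R)$ be the Heisenberg group: $\mathbb R^3$ with the law $(r,s,t)+(r',s',t')=(r+r',\,s+s',\,t+t'+rs'-sr')$. Let $\mathrm{Aut}$ be the group of real matrices $\begin{pmatrix} g&\vec v\\0&1\end{pmatrix}$ with $g\in \mathrm{SL}(2,\mathbb R)$ and $\vec v\in\mathbb R^2$, acting on $\mathbf H(\mathbb R)$ by the automorphisms $(\vec w,t)\mapsto(g^*\vec w,\;t-\vec v^{\,t}g^*\vec w)$, where $g^*=(g^{-1})^t$, and let $\mathrm{Aut}(\mathbb Z)$ be its subgroup of integral matrices. Let $X_{\mathbf H}=\mathrm{Aut}/\mathrm{Aut}(\mathbb Z)$ be the space of Heisenberg lattices, the coset of $h$ corresponding to the lattice $L=h\cdot\mathbb Z^3$, and let $\mu_{\mathbf H}$ be the unique $\mathrm{Aut}$-invariant Borel probability measure on $X_{\mathbf H}$. A point $h\cdot(k,l,n)$ of $L=h\cdot\mathbb Z^3$, with $k,l,n\in\mathbb Z$, is called primitive if $\gcd(k,l)=1$, and for a function $\phi$ on $\mathbb R^3$ put $\Theta^{\mathbf H}\phi(L)=\sum_{\lambda\in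 L\text{ primitive}}\phi(\lambda)$, and $\Theta^{\mathbf H}_S=\Theta^{\mathbf H}\chi_S$ for $S\subset\mathbb R^3$. Let $A\subset\mathbb R^2$ be a Lebesgue measurable set of positive (possibly infinite) Lebesgue measure $m(A)$, let $z\in\mathbb R$ and $0<\epsilon<1$, and let $A^z_\epsilon=(0,0,z)+A\times[0,\epsilon)$ be the $\epsilon$-plate over $A$ at level $z$. Then $\Theta^{\mathbf H}_{A^z_\epsilon}$, as a function with values in $[0,\infty]$, is $\mu_{\mathbf H}$-measurable and $$\int_{X_{\mathbf H}}\bigl|\Theta^{\mathbf H}_{A^z_\epsilon}(L)\bigr|\,d\mu_{\mathbf H}(L)=\frac{\epsilon\, m(A)}{\zeta(2)}.$$ If $m(A)<\infty$, then moreover the sum defining $\Theta^{\mathbf H}_{A^z_\epsilon}(L)$ converges for $\mu_{\mathbf H}$-almost every $L$, the real-valued function $\Theta^{\mathbf H}_{A^z_\epsilon}$ is $\mu_{\mathbf H}$-integrable, and the same formula holds for its integral. -/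

import Mathlib

open MeasureTheory
open scoped ENNReal

noncomputable section

namespace HeisenbergLattice

/-- The underlying set `ℝ³` of the real Heisenberg group. -/
@[ext] structure Heis where
  r : ℝ
  s : ℝ
  t : ℝ

/-- The Heisenberg law
`(r,s,t) + (r',s',t') = (r+r', s+s', t+t'+rs'-sr')` (written additively, not commutative). -/
instance : Add Heis := ⟨fun p q => ⟨p.r + q.r, p.s + q.s, p.t + q.t + p.r * q.s - p.s * q.r⟩⟩

instance : Zero Heis := ⟨⟨0, 0, 0⟩⟩

instance : Neg Heis := ⟨fun p => ⟨-p.r, -p.s, -p.t⟩⟩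

theorem add_def (p q : Heis) :
    p + q = ⟨p.r + q.r, p.s + q.s, p.t + q.t + p.r * q.s - p.s * q.r⟩ := rfl

theorem zero_def : (0 : Heis) = ⟨0, 0, 0⟩ := rfl

theorem neg_def (p : Heis) : -p = ⟨-p.r, -p.s, -p.t⟩ := rfl

instance : AddGroup Heis where
  add_assoc p q u := by
    simp only [add_def]
    ext <;> simp only <;> ring
  zero_add p := by
    simp only [add_def, zero_def]
    ext <;> simp only <;> ring
  add_zero p := by
    simp only [add_def, zero_def]
    ext <;> simp only <;> ring
  neg_add_cancel p := by
    simp only [add_def, zero_def, neg_def]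
    ext <;> simp only <;> ring
  nsmul := nsmulRec
  zsmul := zsmulRec

/-- The coordinates of a point, as a column vector. -/
def Heis.toVec (p : Heis) : Fin 3 → ℝ := ![p.r, p.s, p.t]

/-- The point with a given column vector of coordinates. -/
def Heis.ofVec (v : Fin 3 → ℝ) : Heis := ⟨v 0, v 1, v 2⟩

theorem Heis.toVec_ofVec (v : Fin 3 → ℝ) : (Heis.ofVec v).toVec = v := by
  funext i
  fin_cases i <;> rfl

/-- The group `Aut = SL(2,ℝ) ⋉ ℝ²` of real matrices
`[[a, b, x], [c, d, y], [0, 0, 1]]` with `ad - bc = 1`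
(equivalently: matrices of determinant `1` with last row `(0, 0, 1)`). -/
def Aut : Subgroup (Matrix.SpecialLinearGroup (Fin 3) ℝ) where
  carrier := {M | M.1 2 0 = 0 ∧ M.1 2 1 = 0 ∧ M.1 2 2 = 1}
  one_mem' := by simp
  mul_mem' := by
    rintro M N ⟨h0, h1, h2⟩ ⟨k0, k1, k2⟩
    simp only [Set.mem_ofPred_eq, Matrix.SpecialLinearGroup.coe_mul, Matrix.mul_apply,
      Fin.sum_univ_three]
    simp [h0, h1, h2, k0, k1, k2]
  inv_mem' := by
    rintro M ⟨h0, h1, h2⟩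
    have hd := M.2
    rw [Matrix.det_fin_three] at hd
    simp only [Set.mem_ofPred_eq, Matrix.SpecialLinearGroup.coe_inv, Matrix.adjugate_fin_three]
    simp only [h0, h1, h2] at hd ⊢
    refine ⟨by simp, by simp, ?_⟩
    simp
    linarith

/-- `M` acts on the Heisenberg group by the inverse transpose matrix: for
`M = [[g, v], [0, 1]]` this is `(w, t) ↦ (g* w, t - vᵗ g* w)` with `g* = (g⁻¹)ᵗ`. -/
instance : SMul Aut Heis :=
  ⟨fun M p => Heis.ofVec (((M⁻¹ : Aut).1.1).transpose.mulVec p.toVec)⟩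

theorem smul_def (M : Aut) (p : Heis) :
    M • p = Heis.ofVec (((M⁻¹ : Aut).1.1).transpose.mulVec p.toVec) := rfl

/-- `Aut` acts by automorphisms of the Heisenberg group. -/
instance : DistribMulAction Aut Heis where
  one_smul p := by
    rw [smul_def]
    simp
    rfl
  mul_smul M N p := by
    simp only [smul_def, Heis.toVec_ofVec, Matrix.mulVec_mulVec, mul_inv_rev,
      Subgroup.coe_mul, Matrix.SpecialLinearGroup.coe_mul, Matrix.transpose_mul]
  smul_zero M := by
    rw [smul_def]
    have h : Heis.toVec 0 = 0 := by
      funext i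
      fin_cases i <;> rfl
    rw [h, Matrix.mulVec_zero]
    rfl
  smul_add M p q := by
    simp only [smul_def]
    generalize M⁻¹ = N
    obtain ⟨N, h0, h1, h2⟩ := N
    have hd := N.2
    rw [Matrix.det_fin_three] at hd
    simp only [h0, h1, h2] at hd
    simp only [Heis.ofVec, Heis.toVec, add_def, Matrix.mulVec, dotProduct, Fin.sum_univ_three,
      Matrix.transpose_apply, Matrix.cons_val_zero, Matrix.cons_val_one, Matrix.cons_val, h0, h1,
      h2]
    ext <;> simp only
    · ring
    · ring
    · linear_combination (-(p.r * q.s - p.s * q.r)) * hd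

/-- The group `Aut(ℤ)` of integral points of `Aut`. -/
def AutZ : Subgroup Aut :=
  (Matrix.SpecialLinearGroup.map (n := Fin 3) (Int.castRingHom ℝ)).range.subgroupOf Aut

/-- The space of Heisenberg lattices `X_H = Aut / Aut(ℤ)`; the coset `g Aut(ℤ)` stands for the
lattice `g • ℤ³`, where `ℤ³ = H(ℤ)` is the integral Heisenberg group. -/
def XH : Type := Aut ⧸ AutZ

instance : TopologicalSpace XH := inferInstanceAs (TopologicalSpace (Aut ⧸ AutZ))

instance : MeasurableSpace XH := borel XH

instance : BorelSpace XH := ⟨rfl⟩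

instance : MulAction Aut XH := inferInstanceAs (MulAction Aut (Aut ⧸ AutZ))

/-- The projection `Aut → X_H`. -/
def XH.mk (g : Aut) : XH := (QuotientGroup.mk g : Aut ⧸ AutZ)

/-- The integral point `(k, l, m)` of the Heisenberg group. -/
def intPoint (k l m : ℤ) : Heis := ⟨k, l, m⟩

/-- The primitive points of the lattice `L = g • ℤ³`: the points `g • (k, l, m)` with
`gcd(k, l) = 1`. -/
def primitivePoints (L : XH) : Set Heis :=
  {p | ∃ g : Aut, XH.mk g = L ∧ ∃ k l m : ℤ, Int.gcd k l = 1 ∧ p = g • intPoint k l m}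

theorem mem_AutZ (M : Aut) :
    M ∈ AutZ ↔ ∃ N : Matrix.SpecialLinearGroup (Fin 3) ℤ, ∀ i j, M.1.1 i j = (N.1 i j : ℝ) := by
  simp only [AutZ, Subgroup.mem_subgroupOf, MonoidHom.mem_range]
  constructor
  · rintro ⟨N, h⟩; refine ⟨N, fun i j => ?_⟩; rw [← h]; simp
  · rintro ⟨N, h⟩; refine ⟨N, ?_⟩; ext i j; rw [h]; simp

theorem AutZ_smul_prim {M : Aut} (hM : M ∈ AutZ) (k l m : ℤ) (h : Int.gcd k l = 1) :
    ∃ k' l' m' : ℤ, Int.gcd k' l' = 1 ∧ M • intPoint k l m = intPoint k' l' m' := by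
  obtain ⟨P, hP⟩ := (mem_AutZ _).1 (AutZ.inv_mem hM)
  obtain ⟨h0, h1, h2⟩ := (M⁻¹).2
  rw [hP] at h0 h1 h2
  norm_cast at h0 h1 h2
  have hd := P.2
  rw [Matrix.det_fin_three] at hd
  simp only [h0, h1, h2] at hd
  refine ⟨P.1 0 0 * k + P.1 1 0 * l, P.1 0 1 * k + P.1 1 1 * l, P.1 0 2 * k + P.1 1 2 * l + m, ?_, ?_⟩
  · rw [← Int.isCoprime_iff_gcd_eq_one] at h ⊢
    obtain ⟨u, v, huv⟩ := h
    refine ⟨u * P.1 1 1 - v * P.1 0 1, v * P.1 0 0 - u * P.1 1 0, ?_⟩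
    linear_combination huv * (P.1 0 0 * P.1 1 1 - P.1 0 1 * P.1 1 0) + hd
  · rw [smul_def]
    simp only [Heis.ofVec, Heis.toVec, intPoint, Matrix.mulVec, dotProduct, Fin.sum_univ_three,
      Matrix.transpose_apply, hP, Matrix.cons_val_zero, Matrix.cons_val_one, Matrix.cons_val, h0, h1, h2]
    ext <;> simp 

/-- The primitive points do not depend on the representative `g` of `L`. -/
theorem primitivePoints_mk (g : Aut) : primitivePoints (XH.mk g) =
   {p | ∃ k l m : ℤ, Int.gcd k l = 1 ∧ p = g • intPoint k l m} := by
  ext p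
  constructor
  · rintro ⟨g', hg, k, l, m, h, rfl⟩
    have : g⁻¹ * g' ∈ AutZ := QuotientGroup.eq.1 hg.symm
    obtain ⟨k', l', m', h', e⟩ := AutZ_smul_prim this k l m h
    exact ⟨k', l', m', h', by rw [← e, smul_smul]; simp⟩
  · rintro ⟨k, l, m, h, rfl⟩
    exact ⟨g, rfl, k, l, m, h, rfl⟩

/-- The nil-theta transform `Θ^H φ (L) = ∑ φ(λ)` over the primitive points `λ` of `L`. -/
def nilTheta {E : Type*} [AddCommMonoid E] [TopologicalSpace E] (φ : Heis → E) (L : XH) : E :=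
  ∑' p : primitivePoints L, φ p

/-- The plate `A^z_ε = (0, 0, z) + A × [0, ε)`. -/
def plate (A : Set (ℝ × ℝ)) (z ε : ℝ) : Set Heis :=
  {p | ∃ q : Heis, (q.r, q.s) ∈ A ∧ q.t ∈ Set.Ico 0 ε ∧ p = (⟨0, 0, z⟩ : Heis) + q}

/-- Borel probability measures on `X_H` that are invariant under `Aut`. -/
def IsInvariantProbability (μ : Measure XH) : Prop :=
  IsProbabilityMeasure μ ∧ SMulInvariantMeasure Aut XH μ

open Classical in
/-- The measure `μ_H`: the `Aut`-invariant Borel probability measure on `X_H`, which exists and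
is unique since `Aut(ℤ)` is a lattice in `Aut`. (The value `0` in the other case never occurs.) -/
def muH : Measure XH :=
  if h : ∃ μ : Measure XH, IsInvariantProbability μ then h.choose else 0

end HeisenbergLattice

end

open HeisenbergLattice

/-! The argument is a Siegel-type unfolding. `AutZ` acts transitively on the integral points `(k, l,
m)` with `gcd(k, l) = 1`, and the stabilizer of `(0, 1, 0)` consists of the integral elements with
linear part `[[1, b], [0, 1]]` and translation `(x, 0)`. The set `shearDom` is a fundamental domain
for this stabilizer, so the primitive points of `g • ℤ³` are the `(g * γ) • (0, 1, 0)`, each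
obtained from exactly one `γ` with `g * γ ∈ shearDom` (`bijective_orbit`). Hence the transform of a
plate is the sum over `γ ∈ AutZ` of the indicator of `hitSet ∩ shearDom` at `g * γ`
(`nilTheta_plate_mk`).

An invariant probability measure on `X_H` is the normalized image of Haar measure on a fundamental
domain `fundDom` of `AutZ` (`lintegral_of_invariant`). Unfolding (`lintegral_unfold`), which rests
on right invariance of `haar`, then gives the mean value as `haar (hitSet ∩ shearDom) / haar
fundDom`.

Both volumes are explicit because `haar` is defined as the Lebesgue measure of a cone: a group
element is spread over its multiples by `√D`, `0 < D ≤ 1`, where `D` is the determinant of the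
linear part. In coordinates adapted to the first column (`lintegral_haar`) the integrals separate,
and each contains `∫ D² = 1/3`. They equal `m(A) ε / 3` (`haar_hitSet`) and `π²/18 = ζ(2)/3`
(`haar_fundDom`), so the quotient is `ε m(A) / ζ(2)`.

For a null-measurable base, the formula itself shows that almost no lattice has a primitive point in
the plate over a null set, so the base may be replaced by a Borel one. -/

noncomputable section

namespace HeisenbergLattice

/-! ### Coordinates on `Aut` -/

/-- The entries of a matrix in `Aut`. -/
def ent (g : Aut) (i j : Fin 3) : ℝ := g.1.1 i j

theorem ent_two_zero (g : Aut) : ent g 2 0 = 0 := g.2.1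
theorem ent_two_one (g : Aut) : ent g 2 1 = 0 := g.2.2.1
theorem ent_two_two (g : Aut) : ent g 2 2 = 1 := g.2.2.2

theorem ent_det (g : Aut) : ent g 0 0 * ent g 1 1 - ent g 0 1 * ent g 1 0 = 1 := by
  have h := g.1.2
  rw [Matrix.det_fin_three] at h
  have h0 := ent_two_zero g
  have h1 := ent_two_one g
  have h2 := ent_two_two g
  simp only [ent] at *
  rw [h0, h1, h2] at h
  linarith

theorem ent_ext {g h : Aut} (h00 : ent g 0 0 = ent h 0 0) (h01 : ent g 0 1 = ent h 0 1)
    (h02 : ent g 0 2 = ent h 0 2) (h10 : ent g 1 0 = ent h 1 0) (h11 : ent g 1 1 = ent h 1 1)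
    (h12 : ent g 1 2 = ent h 1 2) : g = h := by
  apply Subtype.ext
  apply Subtype.ext
  ext i j
  change ent g i j = ent h i j
  fin_cases i <;> fin_cases j <;>
    simp_all [ent_two_zero, ent_two_one, ent_two_two]

theorem ent_mul (g h : Aut) (i j : Fin 3) :
    ent (g * h) i j = ent g i 0 * ent h 0 j + ent g i 1 * ent h 1 j + ent g i 2 * ent h 2 j := by
  simp [ent, Matrix.mul_apply, Fin.sum_univ_three]

theorem ent_one (i j : Fin 3) : ent 1 i j = (1 : Matrix (Fin 3) (Fin 3) ℝ) i j := by
  simp [ent]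

/-- The element of `Aut` with given linear part and translation part. -/
def ofCoeff (a b c d x y : ℝ) (h : a * d - b * c = 1) : Aut :=
  ⟨⟨!![a, b, x; c, d, y; 0, 0, 1], by rw [Matrix.det_fin_three]; simp; linarith⟩,
    rfl, rfl, rfl⟩

section ofCoeff

variable (a b c d x y : ℝ) (h : a * d - b * c = 1)

@[simp] theorem ent_ofCoeff_zero_zero : ent (ofCoeff a b c d x y h) 0 0 = a := rfl
@[simp] theorem ent_ofCoeff_zero_one : ent (ofCoeff a b c d x y h) 0 1 = b := rfl
@[simp] theorem ent_ofCoeff_zero_two : ent (ofCoeff a b c d x y h) 0 2 = x := rfl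
@[simp] theorem ent_ofCoeff_one_zero : ent (ofCoeff a b c d x y h) 1 0 = c := rfl
@[simp] theorem ent_ofCoeff_one_one : ent (ofCoeff a b c d x y h) 1 1 = d := rfl
@[simp] theorem ent_ofCoeff_one_two : ent (ofCoeff a b c d x y h) 1 2 = y := rfl

end ofCoeff

theorem inv_eq_ofCoeff (g : Aut) : g⁻¹ = ofCoeff (ent g 1 1) (-ent g 0 1) (-ent g 1 0) (ent g 0 0)
    (ent g 0 1 * ent g 1 2 - ent g 1 1 * ent g 0 2)
    (ent g 1 0 * ent g 0 2 - ent g 0 0 * ent g 1 2) (by linarith [ent_det g]) := by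
  rw [inv_eq_iff_mul_eq_one]
  have := ent_det g
  apply ent_ext <;> simp only [ent_mul, ent_one, ent_ofCoeff_zero_zero, ent_ofCoeff_zero_one,
    ent_ofCoeff_zero_two, ent_ofCoeff_one_zero, ent_ofCoeff_one_one, ent_ofCoeff_one_two,
    ent_two_zero, ent_two_one, ent_two_two] <;> simp <;> grind

theorem smul_eq (g : Aut) (p : Heis) :
    g • p = ⟨ent g 1 1 * p.r - ent g 1 0 * p.s, ent g 0 0 * p.s - ent g 0 1 * p.r,
      p.t - ent g 0 2 * (ent g 1 1 * p.r - ent g 1 0 * p.s)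
        - ent g 1 2 * (ent g 0 0 * p.s - ent g 0 1 * p.r)⟩ := by
  rw [smul_def, inv_eq_ofCoeff]
  simp only [ofCoeff, Heis.ofVec, Heis.toVec, Matrix.mulVec, dotProduct, Fin.sum_univ_three,
    Matrix.transpose_apply]
  ext <;> simp <;> ring

/-- The element of `AutZ` with given integral linear part and translation part. -/
def ofInt (a b c d x y : ℤ) (h : a * d - b * c = 1) : AutZ :=
  ⟨ofCoeff a b c d x y (by exact_mod_cast h), (mem_AutZ _).2
    ⟨⟨!![a, b, x; c, d, y; 0, 0, 1], by rw [Matrix.det_fin_three]; simp; linarith⟩, by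
      intro i j
      fin_cases i <;> fin_cases j <;> simp [ofCoeff]⟩⟩

theorem coe_ofInt (a b c d x y : ℤ) (h : a * d - b * c = 1) :
    (ofInt a b c d x y h : Aut) = ofCoeff a b c d x y (by exact_mod_cast h) := rfl

theorem exists_eq_ofInt (γ : AutZ) :
    ∃ (a b c d x y : ℤ) (h : a * d - b * c = 1), γ = ofInt a b c d x y h := by
  obtain ⟨N, hN⟩ := (mem_AutZ γ.1).1 γ.2
  have hd := ent_det γ.1
  refine ⟨N.1 0 0, N.1 0 1, N.1 1 0, N.1 1 1, N.1 0 2, N.1 1 2, ?_, ?_⟩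
  · simp only [ent, hN] at hd
    exact_mod_cast hd
  · apply Subtype.ext
    rw [coe_ofInt]
    apply ent_ext <;> simp [ent, hN, ofCoeff]

/-! ### Topology and measurable structure -/

/-- This makes `Aut` a Polish space and lets measurability of maps into it be tested entry by entry.
-/
theorem isClosedEmbedding_coe :
    Topology.IsClosedEmbedding (fun g : Aut => (fun i j => ent g i j : Fin 3 → Fin 3 → ℝ)) := by
  have hc : IsClosed (Aut : Set (Matrix.SpecialLinearGroup (Fin 3) ℝ)) := by
    have h : ∀ i j : Fin 3, Continuous fun M : Matrix.SpecialLinearGroup (Fin 3) ℝ => M.1 i j :=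
      fun i j => Continuous.matrix_elem continuous_subtype_val i j
    exact ((isClosed_eq (h 2 0) continuous_const).inter ((isClosed_eq (h 2 1) continuous_const).inter
      (isClosed_eq (h 2 2) continuous_const)))
  exact (Matrix.SpecialLinearGroup.isClosedEmbedding_val (n := Fin 3) (R := ℝ)).comp
    hc.isClosedEmbedding_subtypeVal

instance : PolishSpace Aut := isClosedEmbedding_coe.polishSpace

instance : MeasurableSpace Aut := borel Aut

instance : BorelSpace Aut := ⟨rfl⟩

theorem continuous_ent (i j : Fin 3) : Continuous fun g : Aut => ent g i j :=
  (continuous_apply_apply i j).comp isClosedEmbedding_coe.continuous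

@[fun_prop] theorem measurable_ent (i j : Fin 3) : Measurable fun g : Aut => ent g i j :=
  (continuous_ent i j).measurable

theorem measurable_aut_iff {α : Type*} [MeasurableSpace α] {f : α → Aut} :
    Measurable f ↔ ∀ i j, Measurable fun x => ent (f x) i j := by
  refine ⟨fun h i j => (measurable_ent i j).comp h, fun h => ?_⟩
  refine isClosedEmbedding_coe.measurableEmbedding.measurable_comp_iff.1 ?_
  exact measurable_pi_iff.2 fun i => measurable_pi_iff.2 fun j => h i j

instance : Countable AutZ := by
  have : Function.Surjective fun q : {q : ℤ × ℤ × ℤ × ℤ × ℤ × ℤ //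
      q.1 * q.2.2.2.1 - q.2.1 * q.2.2.1 = 1} => ofInt q.1.1 q.1.2.1 q.1.2.2.1 q.1.2.2.2.1
        q.1.2.2.2.2.1 q.1.2.2.2.2.2 q.2 := by
    intro γ
    obtain ⟨a, b, c, d, x, y, h, rfl⟩ := exists_eq_ofInt γ
    exact ⟨⟨(a, b, c, d, x, y), h⟩, rfl⟩
  exact this.countable

instance isClosed_AutZ : IsClosed (AutZ : Set Aut) := by
  have h : Topology.IsClosedEmbedding (Int.castRingHom ℝ) := Int.isClosedEmbedding_coe_real
  exact (h.specialLinearGroup_map (n := Fin 3)).isClosed_range.preimage continuous_subtype_val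

instance : T1Space XH := inferInstanceAs (T1Space (Aut ⧸ AutZ))

instance : SecondCountableTopology XH :=
  inferInstanceAs (SecondCountableTopology (Aut ⧸ AutZ))

theorem continuous_mk : Continuous XH.mk := QuotientGroup.continuous_mk

theorem surjective_mk : Function.Surjective XH.mk := Quotient.mk_surjective

theorem smul_mk (h g : Aut) : h • XH.mk g = XH.mk (h * g) := rfl

theorem mk_eq_mk {g h : Aut} : XH.mk g = XH.mk h ↔ g⁻¹ * h ∈ AutZ := QuotientGroup.eq

theorem mk_mul_coe (g : Aut) (γ : AutZ) : XH.mk (g * γ) = XH.mk g := by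
  rw [mk_eq_mk]; simp

/-- Measurability on `X_H` can be tested on `Aut`. -/
theorem measurable_comp_mk_iff {β : Type*} [MeasurableSpace β] {f : XH → β} :
    Measurable (fun g => f (XH.mk g)) ↔ Measurable f :=
  -- The nontrivial direction is a Lusin separation argument: under a Borel surjection from a
  -- standard Borel space onto a countably separated one, sets with Borel preimage are measurable.
  Measurable.measurable_comp_iff_of_surjective continuous_mk.measurable surjective_mk

/-! ### Linear maps of the plane -/

/-- The linear map of the plane with matrix `[[p, q], [r, s]]`. -/
def planeMap (p q r s : ℝ) (v : ℝ × ℝ) : ℝ × ℝ := (p * v.1 + q * v.2, r * v.1 + s * v.2)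

@[fun_prop] theorem measurable_planeMap (p q r s : ℝ) : Measurable (planeMap p q r s) := by
  unfold planeMap; fun_prop

theorem map_planeMap (p q r s : ℝ) (h : p * s - q * r ≠ 0) :
    Measure.map (planeMap p q r s) volume
      = ENNReal.ofReal |(p * s - q * r)⁻¹| • (volume : Measure (ℝ × ℝ)) := by
  have hdet : LinearMap.det (Matrix.toLin (Module.Basis.finTwoProd ℝ) (Module.Basis.finTwoProd ℝ)
      !![p, q; r, s]) = p * s - q * r := by
    rw [LinearMap.det_toLin, Matrix.det_fin_two_of]
  have := Measure.map_linearMap_addHaar_eq_smul_addHaar (volume : Measure (ℝ × ℝ))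
    (f := Matrix.toLin (Module.Basis.finTwoProd ℝ) (Module.Basis.finTwoProd ℝ) !![p, q; r, s])
    (by rwa [hdet])
  rw [hdet] at this
  rw [← this]
  congr 1
  funext v
  rw [Matrix.toLin_finTwoProd_apply]
  rfl

theorem measurePreserving_planeMap (p q r s : ℝ) (h : p * s - q * r = 1) :
    MeasurePreserving (planeMap p q r s) :=
  ⟨measurable_planeMap p q r s, by rw [map_planeMap p q r s (by rw [h]; simp), h]; simp⟩

theorem lintegral_comp_planeMap (p q r s : ℝ) (h : p * s - q * r ≠ 0) {f : ℝ × ℝ → ℝ≥0∞}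
    (hf : Measurable f) :
    ∫⁻ v, f (planeMap p q r s v) = ENNReal.ofReal |(p * s - q * r)⁻¹| * ∫⁻ v, f v := by
  rw [← lintegral_map hf (measurable_planeMap p q r s), map_planeMap p q r s h,
    lintegral_smul_measure, smul_eq_mul]

theorem lintegral_comp_planeMap_of_det_eq_one (p q r s : ℝ) (h : p * s - q * r = 1)
    {f : ℝ × ℝ → ℝ≥0∞} (hf : Measurable f) :
    ∫⁻ v, f (planeMap p q r s v) = ∫⁻ v, f v := by
  rw [lintegral_comp_planeMap p q r s (by rw [h]; simp) hf, h]; simp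

/-- Mixing the two columns acts on each row separately by a plane map of determinant one; the
regrouping from columns to rows only permutes coordinates. -/
theorem measurePreserving_columnMap (p q r s : ℝ) (h : p * s - q * r = 1) :
    MeasurePreserving (fun m : (ℝ × ℝ) × (ℝ × ℝ) =>
      ((p * m.1.1 + r * m.2.1, p * m.1.2 + r * m.2.2),
        (q * m.1.1 + s * m.2.1, q * m.1.2 + s * m.2.2))) := by
  have hsw : MeasurePreserving (fun m : (ℝ × ℝ) × (ℝ × ℝ) => ((m.1.1, m.2.1), (m.1.2, m.2.2))) := by
    refine ⟨by fun_prop, ?_⟩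
    have hprod : ∀ F : (ℝ × ℝ) × (ℝ × ℝ) → ℝ≥0∞, Measurable F →
        ∫⁻ m, F m = ∫⁻ a, ∫⁻ b, ∫⁻ c, ∫⁻ d, F ((a, b), (c, d)) := by
      intro F hF
      simp only [Measure.volume_eq_prod]
      rw [lintegral_prod F hF.aemeasurable,
        lintegral_prod (fun x => ∫⁻ y, F (x, y) ∂(volume.prod volume)) (by fun_prop)]
      exact lintegral_congr fun a => lintegral_congr fun b =>
        lintegral_prod (fun y => F ((a, b), y)) (by fun_prop)
    symm
    refine (Measure.ext_of_lintegral _ fun f hf => ?_)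
    rw [lintegral_map hf (by fun_prop), hprod f hf, hprod _ (by fun_prop)]
    exact lintegral_congr fun a => lintegral_lintegral_swap (by fun_prop)
  have h2 := (measurePreserving_planeMap p r q s (by linarith)).prod
    (measurePreserving_planeMap p r q s (by linarith))
  exact (hsw.comp h2).comp hsw

/-! ### The cone over `Aut` and Haar measure -/

/-- Triples of vectors of the plane: two columns and a translation. -/
abbrev Triple : Type := ((ℝ × ℝ) × (ℝ × ℝ)) × (ℝ × ℝ)

/-- The determinant of a matrix given by its columns. -/
def cdet (m : (ℝ × ℝ) × (ℝ × ℝ)) : ℝ := m.1.1 * m.2.2 - m.2.1 * m.1.2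

@[fun_prop] theorem measurable_cdet : Measurable cdet := by unfold cdet; fun_prop

/-- Rescaling of a triple with positive determinant to an element of `Aut`. -/
def toAut (p : Triple) : Aut :=
  if h : 0 < cdet p.1 then
    ofCoeff (p.1.1.1 / √(cdet p.1)) (p.1.2.1 / √(cdet p.1)) (p.1.1.2 / √(cdet p.1))
      (p.1.2.2 / √(cdet p.1)) (p.2.1 / √(cdet p.1)) (p.2.2 / √(cdet p.1)) (by
        rw [div_mul_div_comm, div_mul_div_comm, Real.mul_self_sqrt h.le, ← sub_div]
        exact div_self h.ne')
  else 1

theorem ent_toAut {p : Triple} (h : 0 < cdet p.1) :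
    ent (toAut p) 0 0 = p.1.1.1 / √(cdet p.1) ∧ ent (toAut p) 0 1 = p.1.2.1 / √(cdet p.1) ∧
    ent (toAut p) 1 0 = p.1.1.2 / √(cdet p.1) ∧ ent (toAut p) 1 1 = p.1.2.2 / √(cdet p.1) ∧
    ent (toAut p) 0 2 = p.2.1 / √(cdet p.1) ∧ ent (toAut p) 1 2 = p.2.2 / √(cdet p.1) := by
  rw [toAut, dif_pos h]
  exact ⟨rfl, rfl, rfl, rfl, rfl, rfl⟩

@[fun_prop] theorem measurable_toAut : Measurable toAut := by
  rw [measurable_aut_iff]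
  intro i j
  have hm : MeasurableSet {p : Triple | 0 < cdet p.1} := measurableSet_lt (by fun_prop) (by fun_prop)
  have key : (fun p : Triple => ent (toAut p) i j) = fun p => if 0 < cdet p.1 then
      (!![p.1.1.1 / √(cdet p.1), p.1.2.1 / √(cdet p.1), p.2.1 / √(cdet p.1);
        p.1.1.2 / √(cdet p.1), p.1.2.2 / √(cdet p.1), p.2.2 / √(cdet p.1); 0, 0, 1] i j)
      else (1 : Matrix (Fin 3) (Fin 3) ℝ) i j := by
    funext p
    split_ifs with h
    · rw [toAut, dif_pos h]; rfl
    · rw [toAut, dif_neg h, ent_one]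
  rw [key]
  refine Measurable.ite hm ?_ measurable_const
  fin_cases i <;> fin_cases j <;> simp <;> fun_prop

/-- The triples of determinant in `(0, 1]`. -/
def coneSet : Set Triple := {p | cdet p.1 ∈ Set.Ioc 0 1}

theorem measurableSet_coneSet : MeasurableSet coneSet :=
  (measurable_cdet.comp measurable_fst) measurableSet_Ioc

/-- A Haar measure on `Aut`: the Lebesgue measure of the cone over a set. -/
def haar : Measure Aut := (volume.restrict coneSet).map toAut

/-- A transformation of the group preserves `haar` once it lifts to a volume- and
determinant-preserving map of triples. Both translations are treated this way. -/
theorem map_haar_eq {T : Triple → Triple} (hT : MeasurePreserving T) {S : Aut → Aut}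
    (hS : Measurable S) (hd : ∀ p, cdet (T p).1 = cdet p.1)
    (h : ∀ p, 0 < cdet p.1 → toAut (T p) = S (toAut p)) : haar.map S = haar := by
  have hpre : T ⁻¹' coneSet = coneSet := by ext p; simp [coneSet, hd]
  have h1 : MeasurePreserving T (volume.restrict coneSet) (volume.restrict coneSet) := by
    have := hT.restrict_preimage measurableSet_coneSet
    rwa [hpre] at this
  unfold haar
  rw [Measure.map_map hS measurable_toAut]
  conv_rhs => rw [← h1.map_eq, Measure.map_map measurable_toAut hT.measurable]
  refine Measure.map_congr ?_
  filter_upwards [ae_restrict_mem measurableSet_coneSet] with p hp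
  exact (h p hp.1).symm

theorem measurePreserving_mul_left (g : Aut) : MeasurePreserving (fun x => g * x) haar haar := by
  have hm : Measurable fun x : Aut => g * x := (continuous_const_mul g).measurable
  refine ⟨hm, ?_⟩
  have hg := ent_det g
  have hl := measurePreserving_planeMap (ent g 0 0) (ent g 0 1) (ent g 1 0) (ent g 1 1) hg
  let L := planeMap (ent g 0 0) (ent g 0 1) (ent g 1 0) (ent g 1 1)
  -- `toAut` divides by `√(cdet m)`, so the translation part of `g` has to be multiplied by it in
  -- the lift. The result is a shear in the last vector.
  let t : (ℝ × ℝ) × (ℝ × ℝ) → ℝ × ℝ := fun m => (√(cdet m) * ent g 0 2, √(cdet m) * ent g 1 2)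
  have hT : MeasurePreserving (fun p : Triple => ((L p.1.1, L p.1.2), L p.2 + t p.1)) := by
    refine MeasurePreserving.skew_product (μa := volume) (μb := volume) (μc := volume)
      (μd := volume) (f := Prod.map L L) (g := fun m v => L v + t m) (hl.prod hl) ?_ ?_
    · simp only [Function.uncurry_def, L, t, planeMap]; fun_prop
    · exact ae_of_all _ fun m => ((measurePreserving_add_right volume (t m)).comp hl).map_eq
  have hd : ∀ p : Triple, cdet ((L p.1.1, L p.1.2)) = cdet p.1 := by
    intro p
    simp only [cdet, L, planeMap]
    linear_combination (p.1.1.1 * p.1.2.2 - p.1.2.1 * p.1.1.2) * hg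
  refine map_haar_eq hT hm hd fun p hp => ?_
  have hs : √(cdet p.1) ≠ 0 := (Real.sqrt_pos.2 hp).ne'
  obtain ⟨e1, e2, e3, e4, e5, e6⟩ := ent_toAut hp
  obtain ⟨f1, f2, f3, f4, f5, f6⟩ := ent_toAut
    (p := ((L p.1.1, L p.1.2), L p.2 + t p.1)) (by rw [hd]; exact hp)
  rw [hd] at f1 f2 f3 f4 f5 f6
  generalize toAut ((L p.1.1, L p.1.2), L p.2 + t p.1) = q at f1 f2 f3 f4 f5 f6 ⊢
  apply ent_ext <;> simp only [ent_mul, e1, e2, e3, e4, e5, e6, f1, f2, f3, f4, f5, f6,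
    ent_two_zero, ent_two_one, ent_two_two, L, t, planeMap, Prod.fst_add, Prod.snd_add] <;>
    field_simp <;> ring

theorem measurePreserving_mul_right (g : Aut) : MeasurePreserving (fun x => x * g) haar haar := by
  have hm : Measurable fun x : Aut => x * g := (continuous_mul_const g).measurable
  refine ⟨hm, ?_⟩
  have hg := ent_det g
  -- Multiplication on the right adds to the translation a fixed combination of the columns. This is
  -- homogeneous, so the lift needs no factor `√(cdet m)`.
  let t : (ℝ × ℝ) × (ℝ × ℝ) → ℝ × ℝ := fun m =>
    (ent g 0 2 * m.1.1 + ent g 1 2 * m.2.1, ent g 0 2 * m.1.2 + ent g 1 2 * m.2.2)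
  let C : (ℝ × ℝ) × (ℝ × ℝ) → (ℝ × ℝ) × (ℝ × ℝ) := fun m =>
      ((ent g 0 0 * m.1.1 + ent g 1 0 * m.2.1, ent g 0 0 * m.1.2 + ent g 1 0 * m.2.2),
        (ent g 0 1 * m.1.1 + ent g 1 1 * m.2.1, ent g 0 1 * m.1.2 + ent g 1 1 * m.2.2))
  have hl : MeasurePreserving C := measurePreserving_columnMap _ _ _ _ hg
  have hT : MeasurePreserving (fun p : Triple => (C p.1, p.2 + t p.1)) := by
    refine MeasurePreserving.skew_product (μa := volume) (μb := volume) (μc := volume)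
      (μd := volume) (f := C) (g := fun m v => v + t m) hl ?_ ?_
    · simp only [Function.uncurry_def, t]; fun_prop
    · exact ae_of_all _ fun m => (measurePreserving_add_right volume (t m)).map_eq
  have hd : ∀ p : Triple, cdet (C p.1) = cdet p.1 := by
    intro p
    simp only [cdet, C]
    linear_combination (p.1.1.1 * p.1.2.2 - p.1.2.1 * p.1.1.2) * hg
  refine map_haar_eq hT hm hd fun p hp => ?_
  have hs : √(cdet p.1) ≠ 0 := (Real.sqrt_pos.2 hp).ne'
  obtain ⟨e1, e2, e3, e4, e5, e6⟩ := ent_toAut hp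
  obtain ⟨f1, f2, f3, f4, f5, f6⟩ := ent_toAut
    (p := (C p.1, p.2 + t p.1)) (by rw [hd]; exact hp)
  rw [hd] at f1 f2 f3 f4 f5 f6
  apply ent_ext <;> simp only [ent_mul, e1, e2, e3, e4, e5, e6, f1, f2, f3, f4, f5, f6,
    ent_two_zero, ent_two_one, ent_two_two, C, t, Prod.fst_add, Prod.snd_add] <;>
    field_simp <;> ring

instance : haar.IsMulLeftInvariant := ⟨fun g => (measurePreserving_mul_left g).map_eq⟩

/-- Over a set of matrices with bounded entries the cone is bounded, since its points are those
matrices scaled by `√(cdet) ≤ 1`. -/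
instance : SigmaFinite haar := by
  have hfin : ∀ n : ℕ, haar {g | ∀ i j : Fin 3, |ent g i j| ≤ n} < ⊤ := by
    intro n
    have hmeas : MeasurableSet {g : Aut | ∀ i j : Fin 3, |ent g i j| ≤ n} := by
      simp only [Set.ofPred_forall]
      exact MeasurableSet.iInter fun i => MeasurableSet.iInter fun j =>
        measurableSet_le (by fun_prop) measurable_const
    rw [haar, Measure.map_apply measurable_toAut hmeas,
      Measure.restrict_apply (measurable_toAut hmeas)]
    refine lt_of_le_of_lt (measure_mono ?_) (Metric.isBounded_closedBall (x := (0 : Triple))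
      (r := n)).measure_lt_top
    rintro p ⟨hp, hp0, hp1⟩
    have hs : 0 < √(cdet p.1) := Real.sqrt_pos.2 hp0
    have hs1 : √(cdet p.1) ≤ 1 := Real.sqrt_le_one.2 hp1
    obtain ⟨e1, e2, e3, e4, e5, e6⟩ := ent_toAut hp0
    have key : ∀ (x : ℝ) (i j : Fin 3), ent (toAut p) i j = x / √(cdet p.1) → |x| ≤ n := by
      intro x i j hx
      have h := hp i j
      rw [hx, abs_div, abs_of_pos hs, div_le_iff₀ hs] at h
      nlinarith [abs_nonneg x, (Nat.cast_nonneg n : (0 : ℝ) ≤ n)]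
    simp only [Metric.mem_closedBall, dist_zero_right, Prod.norm_def, Real.norm_eq_abs, sup_le_iff]
    exact ⟨⟨⟨key _ _ _ e1, key _ _ _ e3⟩, key _ _ _ e2, key _ _ _ e4⟩, key _ _ _ e5, key _ _ _ e6⟩
  refine ⟨⟨⟨fun n => {g | ∀ i j : Fin 3, |ent g i j| ≤ n}, fun _ => trivial, hfin, ?_⟩⟩⟩
  refine Set.eq_univ_of_forall fun g => ?_
  obtain ⟨n, hn⟩ := exists_nat_ge (∑ i, ∑ j, |ent g i j|)
  refine Set.mem_iUnion.2 ⟨n, fun i j => le_trans ?_ hn⟩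
  exact (Finset.single_le_sum (f := fun j => |ent g i j|) (fun _ _ => abs_nonneg _)
    (Finset.mem_univ j)).trans (Finset.single_le_sum (f := fun i => ∑ j, |ent g i j|)
    (fun _ _ => Finset.sum_nonneg fun _ _ => abs_nonneg _) (Finset.mem_univ i))

/-! ### Unfolding -/

/-- If the translates of `w` under `AutZ` add up to `1`, integrals over `Aut` unfold. -/
theorem lintegral_unfold {w : Aut → ℝ≥0∞} (hw : Measurable w)
    (h1 : ∀ᵐ g ∂haar, ∑' γ : AutZ, w (g * γ) = 1) {F : Aut → ℝ≥0∞} (hF : Measurable F) :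
    ∫⁻ g, F g ∂haar = ∫⁻ g, w g * ∑' γ : AutZ, F (g * γ) ∂haar := by
  have hm : ∀ γ : Aut, Measurable fun g : Aut => g * γ := fun γ =>
    (continuous_mul_const γ).measurable
  calc ∫⁻ g, F g ∂haar = ∫⁻ g, ∑' γ : AutZ, w (g * γ) * F g ∂haar := by
        refine lintegral_congr_ae ?_
        filter_upwards [h1] with g hg
        rw [ENNReal.tsum_mul_right, hg, one_mul]
    _ = ∑' γ : AutZ, ∫⁻ g, w (g * γ) * F g ∂haar :=
        lintegral_tsum fun γ => ((hw.comp (hm γ)).mul hF).aemeasurable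
    -- Right invariance, that is, unimodularity, moves `γ` from the weight to the integrand.
    _ = ∑' γ : AutZ, ∫⁻ g, w g * F (g * (γ⁻¹ : AutZ)) ∂haar := by
        refine tsum_congr fun γ => ?_
        have := (measurePreserving_mul_right (γ : Aut)).lintegral_comp
          (hw.mul (hF.comp (hm ((γ⁻¹ : AutZ) : Aut))))
        simpa using this
    _ = ∑' γ : AutZ, ∫⁻ g, w g * F (g * γ) ∂haar :=
        (Equiv.inv AutZ).tsum_eq fun γ : AutZ => ∫⁻ g, w g * F (g * γ) ∂haar
    _ = _ := by
        simp_rw [← ENNReal.tsum_mul_left]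
        exact (lintegral_tsum fun γ : AutZ => (hw.mul (hF.comp (hm γ))).aemeasurable).symm

/-! ### A fundamental domain for `AutZ` -/

/-- The squared length of the first column. -/
def colSq (g : Aut) : ℝ := ent g 0 0 ^ 2 + ent g 1 0 ^ 2

theorem colSq_pos (g : Aut) : 0 < colSq g := by
  have h := ent_det g
  unfold colSq
  by_contra hc
  have h0 : ent g 0 0 = 0 := by nlinarith [sq_nonneg (ent g 0 0), sq_nonneg (ent g 1 0)]
  have h1 : ent g 1 0 = 0 := by nlinarith [sq_nonneg (ent g 0 0), sq_nonneg (ent g 1 0)]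
  rw [h0, h1] at h
  norm_num at h

/-- The point of the upper half plane given by the quotient of the two columns. -/
def tau (g : Aut) : UpperHalfPlane :=
  ⟨⟨(ent g 0 0 * ent g 0 1 + ent g 1 0 * ent g 1 1) / colSq g, 1 / colSq g⟩,
    one_div_pos.2 (colSq_pos g)⟩

theorem tau_re (g : Aut) :
    (tau g).re = (ent g 0 0 * ent g 0 1 + ent g 1 0 * ent g 1 1) / colSq g := rfl

/-- The first column as a complex number. -/
def col₁ (g : Aut) : ℂ := ⟨ent g 0 0, ent g 1 0⟩

/-- The second column as a complex number. -/
def col₂ (g : Aut) : ℂ := ⟨ent g 0 1, ent g 1 1⟩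

theorem col₁_ne_zero (g : Aut) : col₁ g ≠ 0 := by
  intro h
  have h1 := congrArg Complex.re h
  have h2 := congrArg Complex.im h
  simp only [col₁, Complex.zero_re, Complex.zero_im] at h1 h2
  have := ent_det g
  rw [h1, h2] at this
  norm_num at this

theorem coe_tau (g : Aut) : (tau g : ℂ) = col₂ g / col₁ g := by
  rw [eq_div_iff (col₁_ne_zero g)]
  have hc := (colSq_pos g).ne'
  have h := ent_det g
  apply Complex.ext
  · simp only [tau, UpperHalfPlane.coe_mk, Complex.mul_re, col₁, col₂]
    field_simp
    unfold colSq
    linear_combination (ent g 1 0) * h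
  · simp only [tau, UpperHalfPlane.coe_mk, Complex.mul_im, col₁, col₂]
    field_simp
    unfold colSq
    linear_combination (-ent g 0 0) * h

theorem normSq_tau (g : Aut) :
    Complex.normSq (tau g) = (ent g 0 1 ^ 2 + ent g 1 1 ^ 2) / colSq g := by
  rw [coe_tau, Complex.normSq_div]
  simp only [Complex.normSq_apply, col₁, col₂, colSq, ← sq]

/-- The Möbius transformation by which an element of `AutZ` acts on `tau`. -/
def mobius (a b c d : ℤ) (h : a * d - b * c = 1) : Matrix.SpecialLinearGroup (Fin 2) ℤ :=
  ⟨!![d, b; c, a], by rw [Matrix.det_fin_two_of]; linarith⟩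

/-- The new columns are `a col₁ + c col₂` and `b col₁ + d col₂`, and `tau` is the quotient of the
second by the first. This turns the right action of `AutZ` into the modular action, which makes the
classical modular domain available. -/
theorem tau_mul (g : Aut) (a b c d x y : ℤ) (h : a * d - b * c = 1) :
    tau (g * ofInt a b c d x y h) = mobius a b c d h • tau g := by
  apply UpperHalfPlane.ext
  have hne := col₁_ne_zero (g * ofInt a b c d x y h)
  have e1 : col₁ (g * ofInt a b c d x y h) = a * col₁ g + c * col₂ g := by
    apply Complex.ext <;> simp [col₁, col₂, ent_mul, coe_ofInt, ent_ofCoeff_zero_zero,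
      ent_ofCoeff_one_zero, ent_two_zero] <;> ring
  have e2 : col₂ (g * ofInt a b c d x y h) = b * col₁ g + d * col₂ g := by
    apply Complex.ext <;> simp [col₁, col₂, ent_mul, coe_ofInt, ent_ofCoeff_zero_one,
      ent_ofCoeff_one_one, ent_two_one] <;> ring
  have key : ((mobius a b c d h • tau g : UpperHalfPlane) : ℂ) =
      (((d : ℝ) : ℂ) * tau g + ((b : ℝ) : ℂ)) / (((c : ℝ) : ℂ) * tau g + ((a : ℝ) : ℂ)) :=
    UpperHalfPlane.coe_specialLinearGroup_apply _ _
  rw [key, coe_tau, coe_tau, e1, e2]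
  rw [e1] at hne
  have h1 := col₁_ne_zero g
  have hne' : (c : ℂ) * (col₂ g / col₁ g) + a ≠ 0 := by
    intro h0
    apply hne
    field_simp at h0
    linear_combination h0
  simp only [Complex.ofReal_intCast]
  rw [div_eq_div_iff hne hne']
  field_simp
  ring

/-- The translation part in the basis of the two columns. -/
def fib₁ (g : Aut) : ℝ := ent g 1 1 * ent g 0 2 - ent g 0 1 * ent g 1 2

/-- The translation part in the basis of the two columns. -/
def fib₂ (g : Aut) : ℝ := ent g 0 0 * ent g 1 2 - ent g 1 0 * ent g 0 2

/-- With `fib₂_mul`: the pair `(fib₁, fib₂)` is first shifted by `(x, y)` and then multiplied by the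
inverse of the integral linear part, so its reduction modulo `ℤ²` can be made after that of `tau`.
-/
theorem fib₁_mul (g : Aut) (a b c d x y : ℤ) (h : a * d - b * c = 1) :
    fib₁ (g * ofInt a b c d x y h) = d * (x + fib₁ g) - b * (y + fib₂ g) := by
  simp only [fib₁, fib₂, ent_mul, coe_ofInt, ent_ofCoeff_zero_zero, ent_ofCoeff_zero_one,
    ent_ofCoeff_zero_two, ent_ofCoeff_one_zero, ent_ofCoeff_one_one, ent_ofCoeff_one_two,
    ent_two_zero, ent_two_one, ent_two_two]
  linear_combination (d * x - b * y : ℝ) * ent_det g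

theorem fib₂_mul (g : Aut) (a b c d x y : ℤ) (h : a * d - b * c = 1) :
    fib₂ (g * ofInt a b c d x y h) = a * (y + fib₂ g) - c * (x + fib₁ g) := by
  simp only [fib₁, fib₂, ent_mul, coe_ofInt, ent_ofCoeff_zero_zero, ent_ofCoeff_zero_one,
    ent_ofCoeff_zero_two, ent_ofCoeff_one_zero, ent_ofCoeff_one_one, ent_ofCoeff_one_two,
    ent_two_zero, ent_two_one, ent_two_two]
  linear_combination (a * y - c * x : ℝ) * ent_det g

/-- A fundamental domain (up to null sets) for the right action of `AutZ` on `Aut`. -/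
def fundDom : Set Aut :=
  {g | tau g ∈ ModularGroup.fdo ∧ 0 < ent g 0 0 ∧ fib₁ g ∈ Set.Ico 0 1 ∧ fib₂ g ∈ Set.Ico 0 1}

theorem eq_of_floor_zero {s : ℝ} {n : ℤ} (h : s ∈ Set.Ico (0 : ℝ) 1)
    (h' : s + n ∈ Set.Ico (0 : ℝ) 1) : n = 0 := by
  have h1 : (n : ℝ) < 1 := by linarith [h.1, h'.2]
  have h2 : (-1 : ℝ) < n := by linarith [h.2, h'.1]
  have h1' : n < 1 := by exact_mod_cast h1
  have h2' : -1 < n := by exact_mod_cast h2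
  omega

/-- The open modular domain leaves only `±1` as linear part, the sign condition on the upper left
entry excludes `-1`, and the unit square excludes nonzero integral translations. -/
theorem eq_one_of_mem_fundDom {g : Aut} {γ : AutZ} (hg : g ∈ fundDom) (hγ : g * γ ∈ fundDom) :
    γ = 1 := by
  obtain ⟨a, b, c, d, x, y, h, rfl⟩ := exists_eq_ofInt γ
  obtain ⟨h1, h2, h3, h4⟩ := hγ
  rw [tau_mul] at h1
  have hsl := ModularGroup.eq_one_or_neg_one_of_mem_fdo_mem_fdo hg.1 h1
  have key : ∀ i j : Fin 2, !![d, b; c, a] i j = (1 : Matrix (Fin 2) (Fin 2) ℤ) i j ∨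
      !![d, b; c, a] i j = -(1 : Matrix (Fin 2) (Fin 2) ℤ) i j := by
    intro i j
    rcases hsl with e | e
    · exact Or.inl (congrFun (congrFun (congrArg Subtype.val e) i) j)
    · exact Or.inr (congrFun (congrFun (congrArg Subtype.val e) i) j)
  have kb : b = 0 := by simpa using key 0 1
  have kc : c = 0 := by simpa using key 1 0
  have ka : a = 1 ∨ a = -1 := by simpa using key 1 1
  have kd : d = 1 ∨ d = -1 := by simpa using key 0 0
  subst kb kc
  rw [fib₁_mul] at h3
  rw [fib₂_mul] at h4
  simp only [ent_mul, coe_ofInt, ent_ofCoeff_zero_zero, ent_ofCoeff_one_zero, ent_two_zero] at h2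
  have ha : a = 1 := by
    rcases ka with ka | ka
    · exact ka
    · have := hg.2.1
      rw [ka] at h2
      push_cast at h2
      linarith
  have hd : d = 1 := by rw [ha] at h; linarith
  subst ha hd
  have hx : x = 0 := eq_of_floor_zero hg.2.2.1 (by convert! h3 using 1; push_cast; ring)
  have hy : y = 0 := eq_of_floor_zero hg.2.2.2 (by convert! h4 using 1; push_cast; ring)
  subst hx hy
  apply Subtype.ext
  rw [coe_ofInt]
  apply ent_ext <;> simp [ent_one]

/-- The exceptional set is the boundary of the modular domain together with the matrices on which
the sign condition is undecided. It is given by polynomial equations on triples, hence null. -/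
theorem ae_generic : ∀ᵐ g ∂haar, |(tau g).re| ≠ 1 / 2 ∧ Complex.normSq (tau g) ≠ 1 ∧
    ent g 0 0 ≠ 0 := by
  have hpoly : ∀ᵐ p : Triple, p.1.1.1 ≠ 0 ∧ p.1.1.2 ≠ 0 ∧
      (2 * (p.1.1.1 * p.1.2.1 + p.1.1.2 * p.1.2.2)) ^ 2 ≠ (p.1.1.1 ^ 2 + p.1.1.2 ^ 2) ^ 2 ∧
      p.1.2.1 ^ 2 + p.1.2.2 ^ 2 ≠ p.1.1.1 ^ 2 + p.1.1.2 ^ 2 := by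
    have hne : ∀ f g : Triple → ℝ, Measurable f → Measurable g → MeasurableSet {p | f p ≠ g p} :=
      fun f g hf hg => (measurableSet_eq_fun hf hg).compl
    have h1 : ∀ᵐ q : (ℝ × ℝ) × (ℝ × ℝ), q.1.1 ≠ 0 ∧ q.1.2 ≠ 0 ∧
        (2 * (q.1.1 * q.2.1 + q.1.2 * q.2.2)) ^ 2 ≠ (q.1.1 ^ 2 + q.1.2 ^ 2) ^ 2 ∧
        q.2.1 ^ 2 + q.2.2 ^ 2 ≠ q.1.1 ^ 2 + q.1.2 ^ 2 := by
      have hn0 : ∀ᵐ a : ℝ, a ≠ 0 := by simp [ae_iff]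
      refine (Measure.ae_prod_iff_ae_ae ?_).2 ?_
      · exact (measurableSet_eq_fun (by fun_prop) (by fun_prop)).compl.inter
          ((measurableSet_eq_fun (by fun_prop) (by fun_prop)).compl.inter
            ((measurableSet_eq_fun (by fun_prop) (by fun_prop)).compl.inter
              (measurableSet_eq_fun (by fun_prop) (by fun_prop)).compl))
      have hA : ∀ᵐ A : ℝ × ℝ, A.1 ≠ 0 ∧ A.2 ≠ 0 := by
        refine (Measure.ae_prod_iff_ae_ae ?_).2 ?_
        · exact (measurableSet_eq_fun (by fun_prop) (by fun_prop)).compl.inter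
            (measurableSet_eq_fun (by fun_prop) (by fun_prop)).compl
        filter_upwards [hn0] with a ha
        filter_upwards [hn0] with c hc using ⟨ha, hc⟩
      filter_upwards [hA] with A hA
      refine (Measure.ae_prod_iff_ae_ae ?_).2 (ae_of_all _ fun b => ?_)
      · exact (MeasurableSet.const _).inter ((MeasurableSet.const _).inter
            ((measurableSet_eq_fun (by fun_prop) (by fun_prop)).compl.inter
              (measurableSet_eq_fun (by fun_prop) (by fun_prop)).compl))
      -- With the first column and `b` fixed, these are the only `d` that can solve one of the two
      -- equations: two roots from the linear equations up to sign, two from the circle.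
      have hfin : Set.Finite {((A.1 ^ 2 + A.2 ^ 2) / 2 - A.1 * b) / A.2,
          (-(A.1 ^ 2 + A.2 ^ 2) / 2 - A.1 * b) / A.2, √(A.1 ^ 2 + A.2 ^ 2 - b ^ 2),
          -√(A.1 ^ 2 + A.2 ^ 2 - b ^ 2)} := by simp
      filter_upwards [compl_mem_ae_iff.2 (hfin.measure_zero volume)] with d hd
      simp only [Set.mem_compl_iff, Set.mem_insert_iff, Set.mem_singleton_iff, not_or] at hd
      obtain ⟨d1, d2, d3, d4⟩ := hd
      refine ⟨hA.1, hA.2, fun h => ?_, fun h => ?_⟩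
      · rcases sq_eq_sq_iff_eq_or_eq_neg.1 h with h | h
        · exact d1 (by rw [eq_div_iff hA.2]; linarith)
        · exact d2 (by rw [eq_div_iff hA.2]; linarith)
      · have h' : d ^ 2 = √(A.1 ^ 2 + A.2 ^ 2 - b ^ 2) ^ 2 := by
          rw [Real.sq_sqrt (by nlinarith [sq_nonneg d])]; linarith
        rcases sq_eq_sq_iff_eq_or_eq_neg.1 h' with h | h
        · exact d3 h
        · exact d4 h
    refine (Measure.ae_prod_iff_ae_ae ?_).2 ?_
    · exact (measurableSet_eq_fun (by fun_prop) (by fun_prop)).compl.inter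
        ((measurableSet_eq_fun (by fun_prop) (by fun_prop)).compl.inter
          ((measurableSet_eq_fun (by fun_prop) (by fun_prop)).compl.inter
            (measurableSet_eq_fun (by fun_prop) (by fun_prop)).compl))
    filter_upwards [h1] with m hm using ae_of_all _ fun _ => hm
  simp only [normSq_tau, tau_re]
  unfold colSq haar
  refine (ae_map_iff (by fun_prop) ?_).2 ?_
  · exact (measurableSet_eq_fun (by fun_prop) (by fun_prop)).compl.inter
      ((measurableSet_eq_fun (by fun_prop) (by fun_prop)).compl.inter
        (measurableSet_eq_fun (by fun_prop) (by fun_prop)).compl)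
  filter_upwards [ae_restrict_of_ae hpoly, ae_restrict_mem measurableSet_coneSet] with p hp hc
  obtain ⟨p1, p2, p3, p4⟩ := hp
  have hs : √(cdet p.1) ≠ 0 := (Real.sqrt_pos.2 hc.1).ne'
  obtain ⟨e1, e2, e3, e4, -, -⟩ := ent_toAut hc.1
  rw [e1, e2, e3, e4]
  have hN : 0 < p.1.1.1 ^ 2 + p.1.1.2 ^ 2 := by positivity
  have hN' : (p.1.1.1 / √(cdet p.1)) ^ 2 + (p.1.1.2 / √(cdet p.1)) ^ 2 ≠ 0 := by positivity
  refine ⟨fun h => p3 ?_, fun h => p4 ?_, div_ne_zero p1 hs⟩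
  · have h' := congrArg (fun x => x ^ 2) h
    simp only [sq_abs] at h'
    field_simp at h'
    linear_combination h'
  · rw [div_eq_one_iff_eq hN'] at h
    field_simp at h
    exact h

/-- The modular group moves `tau g` into the closed domain. For almost every `g` all translates by
the countable group `AutZ` are generic, so the open conditions hold as well. -/
theorem exists_mem_fundDom : ∀ᵐ g : Aut ∂haar, ∃ γ : AutZ, g * γ ∈ fundDom := by
  have hall : ∀ᵐ g : Aut ∂haar, ∀ γ : AutZ, |(tau (g * γ)).re| ≠ 1 / 2 ∧
      Complex.normSq (tau (g * γ)) ≠ 1 ∧ ent (g * γ) 0 0 ≠ 0 :=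
    ae_all_iff.2 fun γ =>
      (measurePreserving_mul_right (γ : Aut)).quasiMeasurePreserving.tendsto_ae.eventually ae_generic
  filter_upwards [hall] with g hg
  obtain ⟨S, hS⟩ := ModularGroup.exists_smul_mem_fd (tau g)
  have hdet := S.2
  rw [Matrix.det_fin_two] at hdet
  have hS' : ∃ a b c d : ℤ, ∃ h : a * d - b * c = 1,
      (∀ x y, tau (g * ofInt a b c d x y h) ∈ ModularGroup.fd) ∧
      (∀ x y, 0 ≤ ent (g * ofInt a b c d x y h) 0 0) := by
    have hfd : ∀ x y, tau (g * ofInt (S.1 1 1) (S.1 0 1) (S.1 1 0) (S.1 0 0) x y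
        (by linarith)) ∈ ModularGroup.fd := by
      intro x y
      rw [tau_mul]
      convert! hS using 2
      ext i j
      fin_cases i <;> fin_cases j <;> rfl
    -- `S` and `-S` act alike on the upper half plane; the choice between them fixes the sign of the
    -- upper left entry.
    have hfd' : ∀ x y, tau (g * ofInt (-S.1 1 1) (-S.1 0 1) (-S.1 1 0) (-S.1 0 0) x y
        (by linarith)) ∈ ModularGroup.fd := by
      intro x y
      rw [tau_mul]
      rw [← ModularGroup.SL_neg_smul S] at hS
      convert! hS using 2
      ext i j
      fin_cases i <;> fin_cases j <;> rfl
    rcases le_total 0 (ent g 0 0 * S.1 1 1 + ent g 0 1 * S.1 1 0) with hs | hs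
    · refine ⟨_, _, _, _, by linarith, hfd, fun x y => ?_⟩
      simp only [ent_mul, coe_ofInt, ent_ofCoeff_zero_zero, ent_ofCoeff_one_zero, ent_two_zero]
      linarith
    · refine ⟨_, _, _, _, by linarith, hfd', fun x y => ?_⟩
      simp only [ent_mul, coe_ofInt, ent_ofCoeff_zero_zero, ent_ofCoeff_one_zero, ent_two_zero]
      push_cast
      linarith
  obtain ⟨a, b, c, d, h, h1, h2⟩ := hS'
  -- the translation part is reduced by subtracting integral parts
  let s := fib₁ (g * ofInt a b c d 0 0 h)
  let t := fib₂ (g * ofInt a b c d 0 0 h)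
  -- `(x, y)` is minus the linear part applied to `(⌊s⌋, ⌊t⌋)`, because `fib` sees translations
  -- through the inverse linear part.
  let x := -(a * ⌊s⌋ + b * ⌊t⌋)
  let y := -(c * ⌊s⌋ + d * ⌊t⌋)
  have hR : (a : ℝ) * d - b * c = 1 := by exact_mod_cast h
  have hs : fib₁ (g * ofInt a b c d x y h) = Int.fract s := by
    rw [fib₁_mul, Int.fract]
    have : s = d * fib₁ g - b * fib₂ g := by simp only [s, fib₁_mul]; push_cast; ring
    simp only [x, y]
    push_cast
    linear_combination (-⌊s⌋ : ℝ) * hR - this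
  have ht : fib₂ (g * ofInt a b c d x y h) = Int.fract t := by
    rw [fib₂_mul, Int.fract]
    have : t = a * fib₂ g - c * fib₁ g := by simp only [t, fib₂_mul]; push_cast; ring
    simp only [x, y]
    push_cast
    linear_combination (-⌊t⌋ : ℝ) * hR - this
  obtain ⟨g1, g2, g3⟩ := hg (ofInt a b c d x y h)
  refine ⟨ofInt a b c d x y h, ⟨?_, ?_⟩, lt_of_le_of_ne (h2 x y) g3.symm, ?_, ?_⟩
  · exact lt_of_le_of_ne (h1 x y).1 g2.symm
  · exact lt_of_le_of_ne (h1 x y).2 g1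
  · rw [hs]; exact ⟨Int.fract_nonneg _, Int.fract_lt_one _⟩
  · rw [ht]; exact ⟨Int.fract_nonneg _, Int.fract_lt_one _⟩

theorem measurableSet_fundDom : MeasurableSet fundDom := by
  have : fundDom = {g | colSq g < ent g 0 1 ^ 2 + ent g 1 1 ^ 2} ∩
      ({g | |ent g 0 0 * ent g 0 1 + ent g 1 0 * ent g 1 1| / colSq g < 1 / 2} ∩
      ({g | 0 < ent g 0 0} ∩ (fib₁ ⁻¹' Set.Ico 0 1 ∩ fib₂ ⁻¹' Set.Ico 0 1))) := by
    ext g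
    have h := colSq_pos g
    simp only [fundDom, ModularGroup.fdo, Set.mem_ofPred_eq, normSq_tau, tau_re, one_lt_div h,
      abs_div, abs_of_pos h, and_assoc, Set.mem_inter_iff, Set.mem_preimage]
  rw [this]
  unfold colSq fib₁ fib₂
  exact (measurableSet_lt (by fun_prop) (by fun_prop)).inter
    ((measurableSet_lt (by fun_prop) (by fun_prop)).inter
      ((measurableSet_lt (by fun_prop) (by fun_prop)).inter
        ((measurableSet_Ico.preimage (by fun_prop)).inter
          (measurableSet_Ico.preimage (by fun_prop)))))

/-- The indicator function of the fundamental domain. -/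
def tile : Aut → ℝ≥0∞ := fundDom.indicator 1

@[fun_prop] theorem measurable_tile : Measurable tile :=
  measurable_one.indicator measurableSet_fundDom

theorem tsum_tile : ∀ᵐ g : Aut ∂haar, ∑' γ : AutZ, tile (g * γ) = 1 := by
  filter_upwards [exists_mem_fundDom] with g hg
  obtain ⟨γ₀, hγ₀⟩ := hg
  rw [tsum_eq_single γ₀]
  · simp [tile, hγ₀]
  · intro γ hγ
    refine Set.indicator_of_notMem (fun hm => hγ ?_) _
    have := eq_one_of_mem_fundDom (γ := γ₀⁻¹ * γ) hγ₀ (by simpa [mul_assoc] using hm)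
    exact (inv_mul_eq_one.1 this).symm

/-! ### Integration over `Aut` in adapted coordinates -/

/-- The coordinates of a vector along `A` and orthogonally to `A`. -/
def frame (A B : ℝ × ℝ) : ℝ × ℝ :=
  ((A.1 * B.1 + A.2 * B.2) / (A.1 ^ 2 + A.2 ^ 2), A.1 * B.2 - B.1 * A.2)

/-- For fixed `A ≠ 0` the map `frame A` is linear of determinant one. -/
theorem lintegral_comp_frame {A : ℝ × ℝ} (hA : A ≠ 0) {f : ℝ × ℝ → ℝ≥0∞} (hf : Measurable f) :
    ∫⁻ B, f (frame A B) = ∫⁻ q, f q := by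
  have hN : A.1 ^ 2 + A.2 ^ 2 ≠ 0 := by
    intro h
    exact hA (Prod.ext (by nlinarith [sq_nonneg A.1, sq_nonneg A.2] : A.1 = 0)
      (by nlinarith [sq_nonneg A.1, sq_nonneg A.2] : A.2 = 0))
  rw [← lintegral_comp_planeMap_of_det_eq_one (A.1 / (A.1 ^ 2 + A.2 ^ 2))
    (A.2 / (A.1 ^ 2 + A.2 ^ 2)) (-A.2) A.1 (by field_simp; ring) hf]
  refine lintegral_congr fun B => congrArg f ?_
  simp only [frame, planeMap]
  exact Prod.ext (by ring) (by ring)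

/-- Fubini on the cone, with the second column and the translation expressed in the frame of the
first column `A`. The second frame coordinate of the second column is the determinant, so the cone
condition involves `q.2` alone and the integral over `A` can be taken inside. -/
theorem lintegral_haar {F : Aut → ℝ≥0∞} (hF : Measurable F)
    {H : (ℝ × ℝ) × (ℝ × ℝ) × (ℝ × ℝ) → ℝ≥0∞} (hH : Measurable H)
    (h : ∀ A B v : ℝ × ℝ, 0 < cdet (A, B) → F (toAut ((A, B), v)) = H (A, frame A B, frame A v)) :
    ∫⁻ g, F g ∂haar = ∫⁻ q : ℝ × ℝ, (Set.Ioc (0 : ℝ) 1).indicator (fun _ =>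
      ∫⁻ A : ℝ × ℝ, ∫⁻ r : ℝ × ℝ, H (A, q, r)) q.2 := by
  have hK : Measurable fun x : (ℝ × ℝ) × (ℝ × ℝ) => ∫⁻ r : ℝ × ℝ, H (x.1, x.2, r) :=
    Measurable.lintegral_prod_right' (f := fun y : ((ℝ × ℝ) × (ℝ × ℝ)) × (ℝ × ℝ) =>
      H (y.1.1, y.1.2, y.2)) (by fun_prop)
  have hI : MeasurableSet {q : ℝ × ℝ | q.2 ∈ Set.Ioc (0 : ℝ) 1} :=
    measurable_snd measurableSet_Ioc
  have hK' : Measurable fun x : (ℝ × ℝ) × (ℝ × ℝ) =>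
      {q : ℝ × ℝ | q.2 ∈ Set.Ioc (0 : ℝ) 1}.indicator (fun q => ∫⁻ r : ℝ × ℝ, H (x.1, q, r)) x.2 :=
    Measurable.indicator (f := fun x : (ℝ × ℝ) × (ℝ × ℝ) => ∫⁻ r : ℝ × ℝ, H (x.1, x.2, r)) hK
      (measurable_snd hI)
  have hA0 : ∀ᵐ A : ℝ × ℝ, A ≠ 0 := by
    have : (volume : Measure (ℝ × ℝ)) {0} = 0 := measure_singleton _
    simpa [ae_iff] using this
  calc ∫⁻ g, F g ∂haar = ∫⁻ p : Triple, coneSet.indicator (fun p => F (toAut p)) p := by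
        rw [haar, lintegral_map hF measurable_toAut, lintegral_indicator measurableSet_coneSet]
    _ = ∫⁻ m : (ℝ × ℝ) × (ℝ × ℝ), ∫⁻ v : ℝ × ℝ,
          coneSet.indicator (fun p => F (toAut p)) (m, v) :=
        lintegral_prod _ ((hF.comp measurable_toAut).indicator measurableSet_coneSet).aemeasurable
    _ = ∫⁻ A : ℝ × ℝ, ∫⁻ B : ℝ × ℝ, ∫⁻ v : ℝ × ℝ,
          coneSet.indicator (fun p => F (toAut p)) ((A, B), v) :=
        lintegral_prod _ (Measurable.lintegral_prod_right'
          ((hF.comp measurable_toAut).indicator measurableSet_coneSet)).aemeasurable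
    _ = ∫⁻ A : ℝ × ℝ, ∫⁻ q : ℝ × ℝ,
          {q : ℝ × ℝ | q.2 ∈ Set.Ioc (0 : ℝ) 1}.indicator (fun q => ∫⁻ r : ℝ × ℝ, H (A, q, r)) q := by
        refine lintegral_congr_ae ?_
        filter_upwards [hA0] with A hA
        refine Eq.trans (lintegral_congr fun B => ?_) (lintegral_comp_frame hA
          (f := fun q => {q : ℝ × ℝ | q.2 ∈ Set.Ioc (0 : ℝ) 1}.indicator
            (fun q => ∫⁻ r : ℝ × ℝ, H (A, q, r)) q) (hK'.comp measurable_prodMk_left))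
        by_cases hc : cdet (A, B) ∈ Set.Ioc (0 : ℝ) 1
        · have hc' : frame A B ∈ {q : ℝ × ℝ | q.2 ∈ Set.Ioc (0 : ℝ) 1} := hc
          rw [Set.indicator_of_mem hc']
          refine Eq.trans (lintegral_congr fun v => ?_) (lintegral_comp_frame hA
            (f := fun r => H (A, frame A B, r)) (by fun_prop))
          rw [Set.indicator_of_mem (show ((A, B), v) ∈ coneSet from hc), h _ _ _ hc.1]
        · have hc' : frame A B ∉ {q : ℝ × ℝ | q.2 ∈ Set.Ioc (0 : ℝ) 1} := hc
          rw [Set.indicator_of_notMem hc']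
          have : ∀ v, coneSet.indicator (fun p => F (toAut p)) ((A, B), v) = 0 := fun v =>
            Set.indicator_of_notMem (show ((A, B), v) ∉ coneSet from hc) _
          simp [this]
    _ = ∫⁻ q : ℝ × ℝ, ∫⁻ A : ℝ × ℝ,
          {q : ℝ × ℝ | q.2 ∈ Set.Ioc (0 : ℝ) 1}.indicator (fun q => ∫⁻ r : ℝ × ℝ, H (A, q, r)) q :=
        lintegral_lintegral_swap hK'.aemeasurable
    _ = _ := by
        refine lintegral_congr fun q => ?_
        by_cases hq : q.2 ∈ Set.Ioc (0 : ℝ) 1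
        · rw [Set.indicator_of_mem hq]
          exact lintegral_congr fun A =>
            Set.indicator_of_mem (show q ∈ {q : ℝ × ℝ | q.2 ∈ Set.Ioc (0 : ℝ) 1} from hq) _
        · rw [Set.indicator_of_notMem hq]
          have : ∀ A, {q : ℝ × ℝ | q.2 ∈ Set.Ioc (0 : ℝ) 1}.indicator
              (fun q => ∫⁻ r : ℝ × ℝ, H (A, q, r)) q = 0 := fun A =>
            Set.indicator_of_notMem
              (show q ∉ {q : ℝ × ℝ | q.2 ∈ Set.Ioc (0 : ℝ) 1} from hq) _
          simp_rw [this, lintegral_zero]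

theorem lintegral_Ioc_sq (k : ℝ) (hk : 0 ≤ k) :
    ∫⁻ D : ℝ, (Set.Ioc (0 : ℝ) 1).indicator (fun D => ENNReal.ofReal (k * D ^ 2)) D
      = ENNReal.ofReal (k / 3) := by
  rw [lintegral_indicator measurableSet_Ioc, ← ofReal_integral_eq_lintegral_ofReal]
  · rw [← intervalIntegral.integral_of_le zero_le_one, intervalIntegral.integral_const_mul,
      integral_pow]
    norm_num
    congr 1
    ring
  · exact (Continuous.integrableOn_Icc (by fun_prop)).mono_set Set.Ioc_subset_Icc_self
  · exact ae_of_all _ fun D => by positivity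

/-- A fundamental domain for the stabilizer of `(0, 1, 0)` in `AutZ`. -/
def shearDom : Set Aut :=
  {g | (ent g 0 0 * ent g 0 1 + ent g 1 0 * ent g 1 1) / colSq g ∈ Set.Ico (0 : ℝ) 1 ∧
    (ent g 0 0 * ent g 0 2 + ent g 1 0 * ent g 1 2) / colSq g ∈ Set.Ico (0 : ℝ) 1}

theorem measurableSet_shearDom : MeasurableSet shearDom := by
  unfold shearDom colSq
  exact (measurableSet_Ico.preimage (by fun_prop)).inter (measurableSet_Ico.preimage (by fun_prop))

/-- The elements of `Aut` that map `(0, 1, 0)` into `B × [z, z + ε)`. -/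
def hitSet (B : Set (ℝ × ℝ)) (z ε : ℝ) : Set Aut :=
  {g | (-ent g 1 0, ent g 0 0) ∈ B ∧
    ent g 0 2 * ent g 1 0 - ent g 1 2 * ent g 0 0 ∈ Set.Ico z (z + ε)}

theorem measurableSet_hitSet {B : Set (ℝ × ℝ)} (hB : MeasurableSet B) (z ε : ℝ) :
    MeasurableSet (hitSet B z ε) :=
  (hB.preimage (by fun_prop)).inter (measurableSet_Ico.preimage (by fun_prop))

/-- At determinant `D`, the first column rotated and scaled by `1/√D` must lie in `B`, which
contributes `D m(B)`. The height is minus the second frame coordinate of the translation divided by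
`D`, which contributes `D ε`. The two shear coordinates range over unit intervals, and integrating
`D²` over `(0, 1]` gives the factor `1/3`. -/
theorem haar_hitSet {B : Set (ℝ × ℝ)} (hB : MeasurableSet B) (z ε : ℝ) (hε : 0 < ε) :
    haar (hitSet B z ε ∩ shearDom) = volume B * ENNReal.ofReal (ε / 3) := by
  let I : Set ℝ := Set.Ico (0 : ℝ) 1
  have hI : MeasurableSet I := measurableSet_Ico
  let H : (ℝ × ℝ) × (ℝ × ℝ) × (ℝ × ℝ) → ℝ≥0∞ := fun x =>
    B.indicator 1 (planeMap 0 (-(1 / √x.2.1.2)) (1 / √x.2.1.2) 0 x.1) * I.indicator 1 x.2.1.1 *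
      (I.indicator 1 x.2.2.1 * (Set.Ico z (z + ε)).indicator 1 (-x.2.2.2 / x.2.1.2))
  have hm1 : ∀ s : Set ℝ, MeasurableSet s → Measurable (s.indicator (1 : ℝ → ℝ≥0∞)) :=
    fun s hs => measurable_one.indicator hs
  have hmB : Measurable (B.indicator (1 : ℝ × ℝ → ℝ≥0∞)) := measurable_one.indicator hB
  have hmI := hm1 I hI
  have hmz := hm1 (Set.Ico z (z + ε)) measurableSet_Ico
  have hH : Measurable H := by
    refine ((hmB.comp ?_).mul (hmI.comp (by fun_prop))).mul
      ((hmI.comp (by fun_prop)).mul (hmz.comp (by fun_prop)))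
    unfold planeMap
    fun_prop
  have hms := (measurableSet_hitSet hB z ε).inter measurableSet_shearDom
  rw [← lintegral_indicator_one hms]
  rw [lintegral_haar (measurable_one.indicator hms) hH]
  · have hr : ∀ D : ℝ, 0 < D →
        ∫⁻ r : ℝ × ℝ, (I.indicator (1 : ℝ → ℝ≥0∞) r.1 *
          (Set.Ico z (z + ε)).indicator (1 : ℝ → ℝ≥0∞) (-r.2 / D)) = ENNReal.ofReal (D * ε) := by
      intro D hD
      rw [Measure.volume_eq_prod, lintegral_prod_mul (f := I.indicator (1 : ℝ → ℝ≥0∞))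
        (g := fun t => (Set.Ico z (z + ε)).indicator (1 : ℝ → ℝ≥0∞) (-t / D)) hmI.aemeasurable
        (hmz.comp (by fun_prop)).aemeasurable, lintegral_indicator_one hI]
      have : (fun t => (Set.Ico z (z + ε)).indicator (1 : ℝ → ℝ≥0∞) (-t / D)) =
          (Set.Ioc (-(D * (z + ε))) (-(D * z))).indicator 1 := by
        funext t
        have : -t / D ∈ Set.Ico z (z + ε) ↔ t ∈ Set.Ioc (-(D * (z + ε))) (-(D * z)) := by
          rw [Set.mem_Ico, Set.mem_Ioc, le_div_iff₀ hD, div_lt_iff₀ hD]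
          constructor <;> rintro ⟨h1, h2⟩ <;> constructor <;> linarith
        by_cases ht : -t / D ∈ Set.Ico z (z + ε)
        · rw [Set.indicator_of_mem ht, Set.indicator_of_mem (this.1 ht)]; rfl
        · rw [Set.indicator_of_notMem ht, Set.indicator_of_notMem (mt this.2 ht)]
      rw [this, lintegral_indicator_one measurableSet_Ioc]
      simp only [I, Real.volume_Ico, Real.volume_Ioc, sub_zero, ENNReal.ofReal_one, one_mul]
      congr 1
      ring
    have hA : ∀ D : ℝ, 0 < D → ∫⁻ A : ℝ × ℝ,
        B.indicator (1 : ℝ × ℝ → ℝ≥0∞) (planeMap 0 (-(1 / √D)) (1 / √D) 0 A)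
          = ENNReal.ofReal D * volume B := by
      intro D hD
      have hd : (0 * 0 - -(1 / √D) * (1 / √D)) = 1 / D := by
        have := Real.mul_self_sqrt hD.le
        have hs := (Real.sqrt_pos.2 hD).ne'
        field_simp
        linarith
      rw [lintegral_comp_planeMap _ _ _ _ (by rw [hd]; positivity) hmB, hd,
        lintegral_indicator_one hB, one_div, inv_inv, abs_of_pos hD]
    calc ∫⁻ q : ℝ × ℝ, (Set.Ioc (0 : ℝ) 1).indicator (fun _ =>
          ∫⁻ A : ℝ × ℝ, ∫⁻ r : ℝ × ℝ, H (A, q, r)) q.2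
        = ∫⁻ q : ℝ × ℝ, I.indicator (1 : ℝ → ℝ≥0∞) q.1 * ((Set.Ioc (0 : ℝ) 1).indicator
            (fun D => ENNReal.ofReal (ε * D ^ 2)) q.2 * volume B) := by
          refine lintegral_congr fun q => ?_
          by_cases hq : q.2 ∈ Set.Ioc (0 : ℝ) 1
          · rw [Set.indicator_of_mem hq, Set.indicator_of_mem hq]
            have e : ∀ A, ∫⁻ r : ℝ × ℝ, H (A, q, r) =
                B.indicator (1 : ℝ × ℝ → ℝ≥0∞) (planeMap 0 (-(1 / √q.2)) (1 / √q.2) 0 A) *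
                  (I.indicator 1 q.1 * ENNReal.ofReal (q.2 * ε)) := by
              intro A
              simp only [H]
              have hm : Measurable fun r : ℝ × ℝ => I.indicator (1 : ℝ → ℝ≥0∞) r.1 *
                  (Set.Ico z (z + ε)).indicator (1 : ℝ → ℝ≥0∞) (-r.2 / q.2) :=
                (hmI.comp measurable_fst).mul (hmz.comp (by fun_prop))
              rw [lintegral_const_mul _ hm, hr _ hq.1, mul_assoc]
            simp_rw [e]
            have hm : Measurable fun A => B.indicator (1 : ℝ × ℝ → ℝ≥0∞)
                (planeMap 0 (-(1 / √q.2)) (1 / √q.2) 0 A) :=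
              hmB.comp (measurable_planeMap _ _ _ _)
            rw [lintegral_mul_const _ hm, hA _ hq.1]
            have he : ENNReal.ofReal (ε * q.2 ^ 2) =
                ENNReal.ofReal q.2 * ENNReal.ofReal (q.2 * ε) := by
              rw [← ENNReal.ofReal_mul hq.1.le]; congr 1; ring
            rw [he]
            ring
          · rw [Set.indicator_of_notMem hq, Set.indicator_of_notMem hq]; simp
      _ = volume B * ENNReal.ofReal (ε / 3) := by
          have hmD : Measurable ((Set.Ioc (0 : ℝ) 1).indicator
              (fun D => ENNReal.ofReal (ε * D ^ 2))) :=
            Measurable.indicator (by fun_prop) measurableSet_Ioc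
          rw [Measure.volume_eq_prod ℝ ℝ, lintegral_prod_mul hmI.aemeasurable
            (g := fun D => (Set.Ioc (0 : ℝ) 1).indicator
              (fun D => ENNReal.ofReal (ε * D ^ 2)) D * (volume.prod volume) B)
            (hmD.mul_const _).aemeasurable,
            lintegral_mul_const _ hmD, lintegral_Ioc_sq ε hε.le, lintegral_indicator_one hI]
          simp [I, mul_comm]
  · intro A C v hc
    obtain ⟨e1, e2, e3, e4, e5, e6⟩ := ent_toAut (p := ((A, C), v)) hc
    have hs : √(cdet (A, C)) ≠ 0 := (Real.sqrt_pos.2 hc).ne'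
    have hss := Real.mul_self_sqrt hc.le
    have hN : A.1 ^ 2 + A.2 ^ 2 ≠ 0 := by
      intro h
      have h1 : A.1 = 0 := by nlinarith [sq_nonneg A.1, sq_nonneg A.2]
      have h2 : A.2 = 0 := by nlinarith [sq_nonneg A.1, sq_nonneg A.2]
      simp [cdet, h1, h2] at hc
    have k1 : (frame A C).2 = cdet (A, C) := by simp only [frame, cdet]
    have k2 : planeMap 0 (-(1 / √(frame A C).2)) (1 / √(frame A C).2) 0 A =
        (-ent (toAut ((A, C), v)) 1 0, ent (toAut ((A, C), v)) 0 0) := by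
      rw [k1, e1, e3]
      simp only [planeMap]
      exact Prod.ext (by ring) (by ring)
    have k3 : (frame A C).1 = (ent (toAut ((A, C), v)) 0 0 * ent (toAut ((A, C), v)) 0 1 +
        ent (toAut ((A, C), v)) 1 0 * ent (toAut ((A, C), v)) 1 1) / colSq (toAut ((A, C), v)) := by
      rw [colSq, e1, e2, e3, e4]
      simp only [frame]
      field_simp
    have k4 : (frame A v).1 = (ent (toAut ((A, C), v)) 0 0 * ent (toAut ((A, C), v)) 0 2 +
        ent (toAut ((A, C), v)) 1 0 * ent (toAut ((A, C), v)) 1 2) / colSq (toAut ((A, C), v)) := by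
      rw [colSq, e1, e3, e5, e6]
      simp only [frame]
      field_simp
    have k5 : -(frame A v).2 / (frame A C).2 =
        ent (toAut ((A, C), v)) 0 2 * ent (toAut ((A, C), v)) 1 0 -
          ent (toAut ((A, C), v)) 1 2 * ent (toAut ((A, C), v)) 0 0 := by
      rw [k1, e1, e3, e5, e6, div_mul_div_comm, div_mul_div_comm, hss]
      simp only [frame]
      ring
    simp only [H, k2, k3, k4, k5]
    generalize toAut ((A, C), v) = g
    have hmem : g ∈ hitSet B z ε ∩ shearDom ↔ ((-ent g 1 0, ent g 0 0) ∈ B ∧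
        ent g 0 2 * ent g 1 0 - ent g 1 2 * ent g 0 0 ∈ Set.Ico z (z + ε)) ∧
        (ent g 0 0 * ent g 0 1 + ent g 1 0 * ent g 1 1) / colSq g ∈ I ∧
        (ent g 0 0 * ent g 0 2 + ent g 1 0 * ent g 1 2) / colSq g ∈ I := Iff.rfl
    classical
    simp only [Set.indicator_apply, hmem, Pi.one_apply]
    clear * -
    split_ifs <;> first | (simp; done) | tauto

/-! ### The volume of the fundamental domain -/

theorem volume_halfDisc (R : ℝ) (hR : 0 < R) :
    volume {A : ℝ × ℝ | 0 < A.1 ∧ A.1 ^ 2 + A.2 ^ 2 < R} = ENNReal.ofReal (Real.pi * R / 2) := by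
  let S : Set (ℝ × ℝ) := {A : ℝ × ℝ | A.1 ^ 2 + A.2 ^ 2 < R}
  let T : Set (ℝ × ℝ) := {A : ℝ × ℝ | 0 < A.1 ∧ A.1 ^ 2 + A.2 ^ 2 < R}
  let T' : Set (ℝ × ℝ) := {A : ℝ × ℝ | A.1 < 0 ∧ A.1 ^ 2 + A.2 ^ 2 < R}
  have hS : MeasurableSet S := measurableSet_lt (by fun_prop) (by fun_prop)
  have hT : MeasurableSet T :=
    (measurableSet_lt measurable_const measurable_fst).inter hS
  have hT' : MeasurableSet T' :=
    (measurableSet_lt measurable_fst measurable_const).inter hS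
  have hvS : volume S = ENNReal.ofReal (Real.pi * R) := by
    have hpre : Complex.measurableEquivRealProd ⁻¹' S = Metric.ball (0 : ℂ) (√R) := by
      ext w
      simp only [S, Set.mem_preimage, Complex.measurableEquivRealProd_apply, Set.mem_ofPred_eq,
        mem_ball_zero_iff]
      rw [Real.lt_sqrt (norm_nonneg w), Complex.sq_norm, Complex.normSq_apply, sq, sq]
    rw [← Complex.volume_preserving_equiv_real_prod.measure_preimage hS.nullMeasurableSet, hpre,
      Complex.volume_ball, ← ENNReal.ofReal_pow (Real.sqrt_nonneg R), Real.sq_sqrt hR.le, mul_comm,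
      mul_comm Real.pi, ENNReal.ofReal_mul hR.le, mul_comm]
    congr 1
    rw [← NNReal.coe_real_pi, ENNReal.ofReal_coe_nnreal]
  -- The two halves are exchanged by `-1`.
  have hTT' : volume T' = volume T := by
    rw [← (measurePreserving_planeMap (-1) 0 0 (-1) (by norm_num)).measure_preimage
      hT.nullMeasurableSet]
    congr 1
    ext A
    simp [T, T', planeMap]
  have h0 : volume {A : ℝ × ℝ | A.1 = 0} = 0 := by
    have : {A : ℝ × ℝ | A.1 = 0} = {0} ×ˢ Set.univ := by ext; simp
    rw [this, Measure.volume_eq_prod, Measure.prod_prod]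
    simp
  have hadd : volume S = volume T + volume T' := by
    rw [← measure_union _ hT']
    · refine measure_congr ?_
      have : ∀ᵐ A : ℝ × ℝ, A.1 ≠ 0 := by rw [ae_iff]; simpa using h0
      filter_upwards [this] with A hA
      apply propext
      change A.1 ^ 2 + A.2 ^ 2 < R ↔ (0 < A.1 ∧ A.1 ^ 2 + A.2 ^ 2 < R) ∨ (A.1 < 0 ∧ A.1 ^ 2 + A.2 ^ 2 < R)
      rcases lt_or_gt_of_ne hA with h | h
      · simp [h, h.le]
      · simp [h, h.le]
    · rw [Set.disjoint_left]
      rintro A ⟨h1, -⟩ ⟨h2, -⟩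
      linarith
  rw [hTT', hvS, ← two_mul] at hadd
  change volume T = _
  rw [show Real.pi * R = 2 * (Real.pi * R / 2) by ring, ENNReal.ofReal_mul (by norm_num),
    ENNReal.ofReal_ofNat] at hadd
  exact ((ENNReal.mul_right_inj (by norm_num) (by norm_num)).1 hadd).symm

theorem lintegral_inv_sqrt :
    ∫⁻ a : ℝ, {a : ℝ | |a| < 1 / 2}.indicator (fun a => ENNReal.ofReal (1 / √(1 - a ^ 2))) a
      = ENNReal.ofReal (Real.pi / 3) := by
  have hset : {a : ℝ | |a| < 1 / 2} = Set.Ioo (-(1 / 2)) (1 / 2) := by ext; simp [abs_lt]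
  have hcont : ContinuousOn (fun a : ℝ => 1 / √(1 - a ^ 2)) (Set.Icc (-(1 / 2)) (1 / 2)) := by
    refine continuousOn_const.div (by fun_prop) fun a ha => (Real.sqrt_pos.2 ?_).ne'
    nlinarith [ha.1, ha.2]
  rw [hset, lintegral_indicator measurableSet_Ioo, Measure.restrict_congr_set Ioo_ae_eq_Ioc,
    ← ofReal_integral_eq_lintegral_ofReal]
  · rw [← intervalIntegral.integral_of_le (by norm_num),
      intervalIntegral.integral_eq_sub_of_hasDerivAt (f := Real.arcsin)]
    · congr 1
      have : Real.arcsin (1 / 2) = Real.pi / 6 := by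
        rw [← Real.sin_pi_div_six]
        exact Real.arcsin_sin (by linarith [Real.pi_pos]) (by linarith [Real.pi_pos])
      rw [Real.arcsin_neg, this]
      ring
    · intro a ha
      rw [Set.uIcc_of_le (by norm_num)] at ha
      exact Real.hasDerivAt_arcsin (by linarith [ha.1]) (by linarith [ha.2])
    · refine ContinuousOn.intervalIntegrable ?_
      rwa [Set.uIcc_of_le (by norm_num)]
  · exact hcont.integrableOn_Icc.mono_set Set.Ioc_subset_Icc_self
  · exact ae_of_all _ fun a => by positivity

/-- At determinant `D` and `Re τ = a`, the first column fills the half disc of squared radius `D /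
√(1 - a²)`, of area `π D / (2 √(1 - a²))`, and the translation contributes `D`. Integration over
`|a| < 1/2` gives `π/3`, integration of `D²` gives `1/3`, and the product is `(π/2)(π/3)(1/3)`. -/
theorem haar_fundDom : haar fundDom = ENNReal.ofReal (Real.pi ^ 2 / 18) := by
  let I : Set ℝ := Set.Ico (0 : ℝ) 1
  have hI : MeasurableSet I := measurableSet_Ico
  let Q : Set ((ℝ × ℝ) × (ℝ × ℝ)) := {x | |x.2.1| < 1 / 2 ∧ 0 < x.1.1 ∧
    (x.1.1 ^ 2 + x.1.2 ^ 2) ^ 2 * (1 - x.2.1 ^ 2) < x.2.2 ^ 2}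
  have hQ : MeasurableSet Q := by
    have : Q = {x | |x.2.1| < 1 / 2} ∩ ({x | 0 < x.1.1} ∩
      {x | (x.1.1 ^ 2 + x.1.2 ^ 2) ^ 2 * (1 - x.2.1 ^ 2) < x.2.2 ^ 2}) := rfl
    rw [this]
    exact (measurableSet_lt (by fun_prop) (by fun_prop)).inter
      ((measurableSet_lt (by fun_prop) (by fun_prop)).inter
        (measurableSet_lt (by fun_prop) (by fun_prop)))
  let H : (ℝ × ℝ) × (ℝ × ℝ) × (ℝ × ℝ) → ℝ≥0∞ := fun x =>
    Q.indicator 1 (x.1, x.2.1) * (I.indicator 1 (x.2.2.1 - x.2.1.1 * (x.2.2.2 / x.2.1.2)) *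
      I.indicator 1 (x.2.2.2 / x.2.1.2))
  have hmI : Measurable (I.indicator (1 : ℝ → ℝ≥0∞)) := measurable_one.indicator hI
  have hmQ : Measurable (Q.indicator (1 : (ℝ × ℝ) × (ℝ × ℝ) → ℝ≥0∞)) :=
    measurable_one.indicator hQ
  have hH : Measurable H :=
    (hmQ.comp (by fun_prop)).mul ((hmI.comp (by fun_prop)).mul (hmI.comp (by fun_prop)))
  rw [← lintegral_indicator_one measurableSet_fundDom,
    lintegral_haar (measurable_one.indicator measurableSet_fundDom) hH]
  · have hr : ∀ a D : ℝ, 0 < D →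
        ∫⁻ r : ℝ × ℝ, (I.indicator (1 : ℝ → ℝ≥0∞) (r.1 - a * (r.2 / D)) *
          I.indicator (1 : ℝ → ℝ≥0∞) (r.2 / D)) = ENNReal.ofReal D := by
      intro a D hD
      have hm : Measurable fun r : ℝ × ℝ => (I.indicator (1 : ℝ → ℝ≥0∞) (r.1 - a * (r.2 / D)) *
          I.indicator (1 : ℝ → ℝ≥0∞) (r.2 / D)) :=
        (hmI.comp (by fun_prop)).mul (hmI.comp (by fun_prop))
      rw [Measure.volume_eq_prod, lintegral_prod_symm _ hm.aemeasurable]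
      have h1 : ∀ t : ℝ, ∫⁻ b : ℝ, (I.indicator (1 : ℝ → ℝ≥0∞) (b - a * (t / D)) *
          I.indicator (1 : ℝ → ℝ≥0∞) (t / D)) = I.indicator (1 : ℝ → ℝ≥0∞) (t / D) := by
        intro t
        have hm' : Measurable fun b : ℝ => I.indicator (1 : ℝ → ℝ≥0∞) (b - a * (t / D)) :=
          hmI.comp (by fun_prop)
        rw [lintegral_mul_const _ hm',
          lintegral_sub_right_eq_self (fun b => I.indicator (1 : ℝ → ℝ≥0∞) b) (a * (t / D)),
          lintegral_indicator_one hI]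
        simp [I]
      simp_rw [h1]
      have h2 : (fun t => I.indicator (1 : ℝ → ℝ≥0∞) (t / D)) = (Set.Ico 0 D).indicator 1 := by
        funext t
        have : t / D ∈ I ↔ t ∈ Set.Ico 0 D := by
          rw [Set.mem_Ico, Set.mem_Ico, le_div_iff₀ hD, div_lt_iff₀ hD, zero_mul, one_mul]
        by_cases ht : t / D ∈ I
        · rw [Set.indicator_of_mem ht, Set.indicator_of_mem (this.1 ht)]; rfl
        · rw [Set.indicator_of_notMem ht, Set.indicator_of_notMem (mt this.2 ht)]
      rw [h2, lintegral_indicator_one measurableSet_Ico]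
      simp
    have hA : ∀ q : ℝ × ℝ, 0 < q.2 → ∫⁻ A : ℝ × ℝ, Q.indicator (1 : (ℝ × ℝ) × (ℝ × ℝ) → ℝ≥0∞) (A, q) =
        {a : ℝ | |a| < 1 / 2}.indicator (fun a => ENNReal.ofReal (1 / √(1 - a ^ 2))) q.1 *
          ENNReal.ofReal (Real.pi / 2 * q.2) := by
      intro q hq
      by_cases ha : |q.1| < 1 / 2
      · have ha' := abs_lt.1 ha
        have hpos : 0 < 1 - q.1 ^ 2 := by nlinarith
        have hs := Real.sqrt_pos.2 hpos
        have hss := Real.sq_sqrt hpos.le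
        rw [Set.indicator_of_mem (show q.1 ∈ {a : ℝ | |a| < 1 / 2} from ha),
          ← ENNReal.ofReal_mul (by positivity)]
        have h1 : (fun A : ℝ × ℝ => Q.indicator (1 : (ℝ × ℝ) × (ℝ × ℝ) → ℝ≥0∞) (A, q)) =
            {A : ℝ × ℝ | 0 < A.1 ∧ A.1 ^ 2 + A.2 ^ 2 < q.2 / √(1 - q.1 ^ 2)}.indicator 1 := by
          funext A
          have : (A, q) ∈ Q ↔
              A ∈ {A : ℝ × ℝ | 0 < A.1 ∧ A.1 ^ 2 + A.2 ^ 2 < q.2 / √(1 - q.1 ^ 2)} := by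
            simp only [Q, Set.mem_ofPred_eq, ha, true_and]
            refine and_congr_right fun _ => ?_
            rw [lt_div_iff₀ hs, ← sq_lt_sq₀ (by positivity) hq.le, mul_pow, hss]
          by_cases hm : (A, q) ∈ Q
          · rw [Set.indicator_of_mem hm, Set.indicator_of_mem (this.1 hm)]; rfl
          · rw [Set.indicator_of_notMem hm, Set.indicator_of_notMem (mt this.2 hm)]
        rw [h1, lintegral_indicator_one, volume_halfDisc _ (by positivity)]
        · congr 1
          field_simp
        · have hm1 : MeasurableSet {A : ℝ × ℝ | 0 < A.1} :=
            measurableSet_lt (by fun_prop) (by fun_prop)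
          have hm2 : MeasurableSet {A : ℝ × ℝ | A.1 ^ 2 + A.2 ^ 2 < q.2 / √(1 - q.1 ^ 2)} :=
            measurableSet_lt (by fun_prop) (by fun_prop)
          exact hm1.inter hm2
      · rw [Set.indicator_of_notMem (show q.1 ∉ {a : ℝ | |a| < 1 / 2} from ha), zero_mul]
        have : ∀ A : ℝ × ℝ, Q.indicator (1 : (ℝ × ℝ) × (ℝ × ℝ) → ℝ≥0∞) (A, q) = 0 := fun A =>
          Set.indicator_of_notMem (fun h => ha h.1) _
        simp_rw [this, lintegral_zero]
    calc ∫⁻ q : ℝ × ℝ, (Set.Ioc (0 : ℝ) 1).indicator (fun _ =>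
          ∫⁻ A : ℝ × ℝ, ∫⁻ r : ℝ × ℝ, H (A, q, r)) q.2
        = ∫⁻ q : ℝ × ℝ,
            {a : ℝ | |a| < 1 / 2}.indicator (fun a => ENNReal.ofReal (1 / √(1 - a ^ 2))) q.1 *
            (Set.Ioc (0 : ℝ) 1).indicator (fun D => ENNReal.ofReal (Real.pi / 2 * D ^ 2)) q.2 := by
          refine lintegral_congr fun q => ?_
          by_cases hq : q.2 ∈ Set.Ioc (0 : ℝ) 1
          · rw [Set.indicator_of_mem hq, Set.indicator_of_mem hq]
            have e : ∀ A, ∫⁻ r : ℝ × ℝ, H (A, q, r) =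
                Q.indicator (1 : (ℝ × ℝ) × (ℝ × ℝ) → ℝ≥0∞) (A, q) * ENNReal.ofReal q.2 := by
              intro A
              have hm : Measurable fun r : ℝ × ℝ => I.indicator (1 : ℝ → ℝ≥0∞)
                  (r.1 - q.1 * (r.2 / q.2)) * I.indicator (1 : ℝ → ℝ≥0∞) (r.2 / q.2) :=
                (hmI.comp (by fun_prop)).mul (hmI.comp (by fun_prop))
              simp only [H]
              rw [lintegral_const_mul _ hm, hr _ _ hq.1]
            simp_rw [e]
            have hm : Measurable fun A : ℝ × ℝ => Q.indicator (1 : (ℝ × ℝ) × (ℝ × ℝ) → ℝ≥0∞) (A, q) :=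
              hmQ.comp measurable_prodMk_right
            rw [lintegral_mul_const _ hm, hA _ hq.1, mul_assoc, ← ENNReal.ofReal_mul
              (mul_nonneg (by positivity) hq.1.le)]
            congr 2
            ring
          · rw [Set.indicator_of_notMem hq, Set.indicator_of_notMem hq, mul_zero]
      _ = ENNReal.ofReal (Real.pi ^ 2 / 18) := by
          rw [Measure.volume_eq_prod ℝ ℝ, lintegral_prod_mul, lintegral_inv_sqrt,
            lintegral_Ioc_sq _ (by positivity), ← ENNReal.ofReal_mul (by positivity)]
          · congr 1
            ring
          · exact (Measurable.indicator (by fun_prop)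
              (measurableSet_lt (by fun_prop) (by fun_prop))).aemeasurable
          · exact (Measurable.indicator (by fun_prop) measurableSet_Ioc).aemeasurable
  · intro A C v hc
    obtain ⟨e1, e2, e3, e4, e5, e6⟩ := ent_toAut (p := ((A, C), v)) hc
    have hs0 : 0 < √(cdet (A, C)) := Real.sqrt_pos.2 hc
    have hs : √(cdet (A, C)) ≠ 0 := hs0.ne'
    have hss := Real.mul_self_sqrt hc.le
    have hN : 0 < A.1 ^ 2 + A.2 ^ 2 := by
      by_contra h
      have h1 : A.1 = 0 := by nlinarith [sq_nonneg A.1, sq_nonneg A.2]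
      have h2 : A.2 = 0 := by nlinarith [sq_nonneg A.1, sq_nonneg A.2]
      simp [cdet, h1, h2] at hc
    have k1 : (frame A C).2 = cdet (A, C) := by simp only [frame, cdet]
    have k2 : fib₂ (toAut ((A, C), v)) = (frame A v).2 / (frame A C).2 := by
      rw [fib₂, e1, e3, e5, e6, k1, div_mul_div_comm, div_mul_div_comm, hss]
      simp only [frame]
      ring
    have k3 : fib₁ (toAut ((A, C), v)) =
        (frame A v).1 - (frame A C).1 * ((frame A v).2 / (frame A C).2) := by
      rw [fib₁, e2, e4, e5, e6, k1, div_mul_div_comm, div_mul_div_comm, hss]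
      have hc' : cdet (A, C) ≠ 0 := hc.ne'
      field_simp
      simp only [frame]
      field_simp
      simp only [cdet]
      ring
    have k4 : (tau (toAut ((A, C), v))).re = (frame A C).1 := by
      rw [tau_re, colSq, e1, e2, e3, e4]
      simp only [frame]
      field_simp
    have k5 : 1 < Complex.normSq (tau (toAut ((A, C), v))) ↔
        (A.1 ^ 2 + A.2 ^ 2) ^ 2 * (1 - (frame A C).1 ^ 2) < (frame A C).2 ^ 2 := by
      have : Complex.normSq (tau (toAut ((A, C), v))) = (C.1 ^ 2 + C.2 ^ 2) / (A.1 ^ 2 + A.2 ^ 2) := by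
        rw [normSq_tau, colSq, e1, e2, e3, e4]
        field_simp
      rw [this, one_lt_div hN]
      -- Lagrange's identity: `|A|² |C|²` is the square of the scalar product plus the square of the
      -- determinant.
      have e : (A.1 ^ 2 + A.2 ^ 2) ^ 2 * (1 - (frame A C).1 ^ 2) - (frame A C).2 ^ 2 =
          (A.1 ^ 2 + A.2 ^ 2) * ((A.1 ^ 2 + A.2 ^ 2) - (C.1 ^ 2 + C.2 ^ 2)) := by
        simp only [frame]
        field_simp
        ring
      constructor
      · intro h; nlinarith
      · intro h; nlinarith
    have k6 : 0 < ent (toAut ((A, C), v)) 0 0 ↔ 0 < A.1 := by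
      rw [e1]; exact div_pos_iff_of_pos_right hs0
    have hmem : toAut ((A, C), v) ∈ fundDom ↔ (A, frame A C) ∈ Q ∧
        (frame A v).1 - (frame A C).1 * ((frame A v).2 / (frame A C).2) ∈ I ∧
        (frame A v).2 / (frame A C).2 ∈ I := by
      rw [← k3, ← k2]
      simp only [fundDom, ModularGroup.fdo, Set.mem_ofPred_eq, k4, k5, k6, Q, I]
      tauto
    classical
    simp only [H, Set.indicator_apply, hmem, Pi.one_apply]
    clear * -
    split_ifs <;> first | (simp; done) | tauto

/-! ### Existence and uniqueness of the invariant measure -/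

/-- Any weight whose translates add up to `1` defines the same integral on `X_H`, by unfolding with
`tile`. Invariance of the quotient measure reduces to this. -/
theorem lintegral_tile_eq {w : Aut → ℝ≥0∞} (hw : Measurable w)
    (h1 : ∀ᵐ g : Aut ∂haar, ∑' γ : AutZ, w (g * γ) = 1) {f : XH → ℝ≥0∞} (hf : Measurable f) :
    ∫⁻ g, w g * f (XH.mk g) ∂haar = ∫⁻ g, tile g * f (XH.mk g) ∂haar := by
  have hf' : Measurable fun g => f (XH.mk g) := measurable_comp_mk_iff.2 hf
  have hwf : Measurable fun g => w g * f (XH.mk g) := hw.mul hf'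
  rw [lintegral_unfold measurable_tile tsum_tile hwf]
  refine lintegral_congr_ae ?_
  filter_upwards [h1] with g hg
  simp only [mk_mul_coe]
  rw [ENNReal.tsum_mul_right, hg, one_mul]

theorem haar_fundDom_ne_zero : haar fundDom ≠ 0 := by
  rw [haar_fundDom, Ne, ENNReal.ofReal_eq_zero, not_le]
  positivity

theorem haar_fundDom_ne_top : haar fundDom ≠ ⊤ := by
  rw [haar_fundDom]; exact ENNReal.ofReal_ne_top

theorem lintegral_tile_mul (f : Aut → ℝ≥0∞) :
    ∫⁻ g, tile g * f g ∂haar = ∫⁻ g in fundDom, f g ∂haar := by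
  rw [← lintegral_indicator measurableSet_fundDom]
  refine lintegral_congr fun g => ?_
  by_cases hg : g ∈ fundDom <;> simp [tile, hg]

theorem exists_invariantProbability : ∃ μ : Measure XH, IsInvariantProbability μ := by
  have hmk : Measurable XH.mk := continuous_mk.measurable
  refine ⟨(haar fundDom)⁻¹ • (haar.restrict fundDom).map XH.mk, ⟨⟨?_⟩, ⟨fun c s hs => ?_⟩⟩⟩
  · rw [Measure.smul_apply, Measure.map_apply hmk MeasurableSet.univ, Set.preimage_univ,
      Measure.restrict_apply_univ, smul_eq_mul,
      ENNReal.inv_mul_cancel haar_fundDom_ne_zero haar_fundDom_ne_top]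
  · have hc : Measurable fun g : Aut => c * g := (continuous_const_mul c).measurable
    have hc' : Measurable fun g : Aut => c⁻¹ * g := (continuous_const_mul c⁻¹).measurable
    have hcs : MeasurableSet ((fun x : XH => c • x) ⁻¹' s) := by
      refine MeasurableSet.preimage hs (measurable_comp_mk_iff.1 ?_)
      exact hmk.comp hc
    rw [Measure.smul_apply, Measure.smul_apply]
    congr 1
    have key : ∀ t : Set XH, MeasurableSet t → (haar.restrict fundDom).map XH.mk t
        = ∫⁻ g, tile g * t.indicator 1 (XH.mk g) ∂haar := by
      intro t ht
      rw [Measure.map_apply hmk ht, lintegral_tile_mul,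
        ← lintegral_indicator_one (hmk ht)]
      rfl
    rw [key _ hcs, key _ hs]
    -- The left-translated tile is again an admissible weight, since left and right multiplication
    -- commute.
    have hw : ∀ᵐ g : Aut ∂haar, ∑' γ : AutZ, tile (c⁻¹ * (g * γ)) = 1 := by
      have := (measurePreserving_mul_left c⁻¹).quasiMeasurePreserving.tendsto_ae.eventually
        tsum_tile
      simpa only [mul_assoc] using this
    rw [← lintegral_tile_eq (measurable_tile.comp hc') hw (measurable_one.indicator hs)]
    have hF : Measurable fun g => tile (c⁻¹ * g) * s.indicator (1 : XH → ℝ≥0∞) (XH.mk g) :=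
      (measurable_tile.comp hc').mul ((measurable_one.indicator hs).comp hmk)
    have := (measurePreserving_mul_left c).lintegral_comp hF
    simp only [inv_mul_cancel_left] at this
    exact this

/-- A representative of a lattice. -/
def repr (x : XH) : Aut := Function.surjInv surjective_mk x

theorem mk_repr (x : XH) : XH.mk (repr x) = x := Function.surjInv_eq surjective_mk x

/-- `repr` is a bare choice with no measurability; sums over a coset do not depend on it, which is
how measurability is recovered. -/
theorem tsum_repr (F : Aut → ℝ≥0∞) (g : Aut) :
    ∑' γ : AutZ, F (repr (XH.mk g) * γ) = ∑' γ : AutZ, F (g * γ) := by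
  have h : g⁻¹ * repr (XH.mk g) ∈ AutZ := mk_eq_mk.1 (mk_repr (XH.mk g)).symm
  rw [← (Equiv.mulLeft (⟨g⁻¹ * repr (XH.mk g), h⟩ : AutZ)).tsum_eq fun γ : AutZ => F (g * γ)]
  refine tsum_congr fun γ => congrArg F ?_
  simp [mul_assoc]

/-- The counting measure of a coset of `AutZ`. -/
def cosetMeasure (x : XH) : Measure Aut := Measure.sum fun γ : AutZ => Measure.dirac (repr x * γ)

theorem lintegral_cosetMeasure (x : XH) {F : Aut → ℝ≥0∞} (hF : Measurable F) :
    ∫⁻ g, F g ∂cosetMeasure x = ∑' γ : AutZ, F (repr x * γ) := by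
  rw [cosetMeasure, lintegral_sum_measure]
  exact tsum_congr fun γ => lintegral_dirac' _ hF

theorem measurable_tsum_mul {F : Aut → ℝ≥0∞} (hF : Measurable F) :
    Measurable fun g : Aut => ∑' γ : AutZ, F (g * γ) :=
  Measurable.tsum fun γ => hF.comp (continuous_mul_const (γ : Aut)).measurable

theorem measurable_cosetMeasure : Measurable cosetMeasure := by
  refine Measure.measurable_of_measurable_coe _ fun s hs => measurable_comp_mk_iff.1 ?_
  have h1 : Measurable (s.indicator (1 : Aut → ℝ≥0∞)) := measurable_one.indicator hs
  simp_rw [← lintegral_indicator_one hs, lintegral_cosetMeasure _ h1, tsum_repr]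
  exact measurable_tsum_mul h1

instance : MeasurableConstSMul Aut XH :=
  ⟨fun c => measurable_comp_mk_iff.1
    (continuous_mk.measurable.comp (continuous_const_mul c).measurable)⟩

theorem cosetMeasure_smul (h : Aut) (x : XH) {s : Set Aut} (hs : MeasurableSet s) :
    cosetMeasure (h • x) s = cosetMeasure x ((fun g => h * g) ⁻¹' s) := by
  obtain ⟨g, rfl⟩ := surjective_mk x
  have hm : Measurable fun g : Aut => h * g := (continuous_const_mul h).measurable
  rw [smul_mk, ← lintegral_indicator_one hs, ← lintegral_indicator_one (hm hs),
    lintegral_cosetMeasure _ (measurable_one.indicator hs),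
    lintegral_cosetMeasure _ (measurable_one.indicator (hm hs)), tsum_repr, tsum_repr]
  refine tsum_congr fun γ => ?_
  rw [mul_assoc]
  rfl

theorem tsum_indicator_le_one {s : Set Aut} (hs : ∀ u ∈ s, ∀ v ∈ s, u⁻¹ * v ∈ AutZ → u = v)
    (g : Aut) : ∑' γ : AutZ, s.indicator (1 : Aut → ℝ≥0∞) (g * γ) ≤ 1 := by
  by_cases h : ∃ γ₀ : AutZ, g * γ₀ ∈ s
  · obtain ⟨γ₀, hγ₀⟩ := h
    rw [tsum_eq_single γ₀]
    · simp [hγ₀]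
    · intro γ hγ
      refine Set.indicator_of_notMem (fun hm => hγ ?_) _
      have := hs _ hγ₀ _ hm (by simpa [mul_assoc] using (γ₀⁻¹ * γ).2)
      exact (Subtype.ext (mul_left_cancel this)).symm
  · have : ∀ γ : AutZ, s.indicator (1 : Aut → ℝ≥0∞) (g * γ) = 0 := fun γ =>
      Set.indicator_of_notMem (fun hm => h ⟨γ, hm⟩) _
    simp [this]

/-- `AutZ` is discrete: an integral matrix whose entries differ from those of `1` by less than `1`
is `1`. -/
theorem exists_nhds_injOn : ∃ U : Set Aut, IsOpen U ∧ 1 ∈ U ∧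
    ∀ u ∈ U, ∀ v ∈ U, u⁻¹ * v ∈ AutZ → u = v := by
  let W : Set Aut := {g | ∀ i j, |ent g i j - ent 1 i j| < 1}
  have hW : IsOpen W := by
    have : W = ⋂ i, ⋂ j, {g | |ent g i j - ent 1 i j| < 1} := by ext; simp [W]
    rw [this]
    exact isOpen_iInter_of_finite fun i => isOpen_iInter_of_finite fun j =>
      isOpen_lt (((continuous_ent i j).sub continuous_const).abs) continuous_const
  have hW1 : ∀ g ∈ W, g ∈ AutZ → g = 1 := by
    intro g hg hgz
    obtain ⟨N, hN⟩ := (mem_AutZ g).1 hgz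
    have key : ∀ i j, ent g i j = ent 1 i j := by
      intro i j
      have h := hg i j
      have h1 : ent 1 i j = (((1 : Matrix (Fin 3) (Fin 3) ℤ) i j : ℤ) : ℝ) := by
        rw [ent_one, Matrix.one_apply, Matrix.one_apply]; split_ifs <;> simp
      have h2 : ent g i j = (N.1 i j : ℝ) := hN i j
      rw [h1, h2] at h ⊢
      have h3 : |N.1 i j - (1 : Matrix (Fin 3) (Fin 3) ℤ) i j| < 1 := by exact_mod_cast h
      rw [Int.abs_lt_one_iff, sub_eq_zero] at h3
      rw [h3]
    exact ent_ext (key _ _) (key _ _) (key _ _) (key _ _) (key _ _) (key _ _)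
  have hc : Continuous fun p : Aut × Aut => p.1⁻¹ * p.2 := by fun_prop
  have hW' : (fun p : Aut × Aut => p.1⁻¹ * p.2) ⁻¹' W ∈ nhds ((1 : Aut), (1 : Aut)) := by
    refine (hW.preimage hc).mem_nhds ?_
    simp [W]
  rw [nhds_prod_eq, Filter.mem_prod_same_iff] at hW'
  obtain ⟨t, ht, htW⟩ := hW'
  obtain ⟨U, hUt, hU, h1⟩ := mem_nhds_iff.1 ht
  refine ⟨U, hU, h1, fun u hu v hv huv => ?_⟩
  have := hW1 _ (htW (Set.mk_mem_prod (hUt hu) (hUt hv))) huv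
  exact inv_mul_eq_one.1 this

/-- Averaging the counting measures of the cosets against `μ` gives a left-invariant measure `ν` on
`Aut`, so uniqueness of Haar measure makes `ν` a multiple of `haar`. Testing `ν` on `tile * f`
recovers `μ`. In particular the choice made in `muH` is immaterial. -/
theorem lintegral_of_invariant {μ : Measure XH} (hμ : IsInvariantProbability μ) {f : XH → ℝ≥0∞}
    (hf : Measurable f) :
    ∫⁻ x, f x ∂μ = (haar fundDom)⁻¹ * ∫⁻ g, tile g * f (XH.mk g) ∂haar := by
  obtain ⟨hp, hi⟩ := hμ
  let ν : Measure Aut := μ.bind cosetMeasure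
  have hν : ∀ s, MeasurableSet s → ν s = ∫⁻ x, cosetMeasure x s ∂μ := fun s hs =>
    Measure.bind_apply hs measurable_cosetMeasure.aemeasurable
  have hinv : ν.IsMulLeftInvariant := by
    refine ⟨fun h => Measure.ext fun s hs => ?_⟩
    have hm : Measurable fun g : Aut => h * g := (continuous_const_mul h).measurable
    rw [Measure.map_apply hm hs, hν _ (hm hs), hν _ hs]
    simp_rw [← cosetMeasure_smul h _ hs]
    exact (measurePreserving_smul h μ).lintegral_comp
      (f := fun x => cosetMeasure x s) (Measure.measurable_coe hs |>.comp measurable_cosetMeasure)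
  -- Every coset meets a small open set at most once and `μ` has mass one, so that open set has
  -- `ν`-measure at most one.
  have hlf : IsLocallyFiniteMeasure ν := by
    obtain ⟨U, hU, h1, hinj⟩ := exists_nhds_injOn
    refine ⟨fun h => ⟨(fun g => h⁻¹ * g) ⁻¹' U,
      (hU.preimage (continuous_const_mul h⁻¹)).mem_nhds (by simpa using h1), ?_⟩⟩
    have hV : MeasurableSet ((fun g => h⁻¹ * g) ⁻¹' U) :=
      (hU.preimage (continuous_const_mul h⁻¹)).measurableSet
    rw [hν _ hV]
    refine lt_of_le_of_lt (lintegral_mono fun x => ?_) (b := ∫⁻ _, 1 ∂μ) (by simp)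
    rw [← lintegral_indicator_one hV, lintegral_cosetMeasure _ (measurable_one.indicator hV)]
    refine tsum_indicator_le_one (fun u hu v hv huv => ?_) _
    have := hinj _ hu _ hv (by simpa [mul_assoc] using huv)
    exact mul_left_cancel this
  have hsf : SigmaFinite ν := inferInstance
  have huniq := measure_eq_div_smul ν haar haar_fundDom_ne_zero haar_fundDom_ne_top
  have hac : ν ≪ haar := by
    rw [huniq]; exact Measure.smul_absolutelyContinuous
  -- The bad set is `haar`-null, hence `ν`-null, so `μ`-almost every coset avoids it entirely; the
  -- term `γ = 1` yields the claim at the representative.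
  have htile : ∀ᵐ x ∂μ, ∑' γ : AutZ, tile (repr x * γ) = 1 := by
    let N : Set Aut := {g | ∑' γ : AutZ, tile (g * γ) ≠ 1}
    have hN : MeasurableSet N :=
      (measurableSet_eq_fun (measurable_tsum_mul measurable_tile) measurable_const).compl
    have h0 : ν N = 0 := hac (ae_iff.1 tsum_tile)
    have hm : Measurable fun x => cosetMeasure x N :=
      (Measure.measurable_coe hN).comp measurable_cosetMeasure
    rw [hν _ hN, lintegral_eq_zero_iff hm] at h0
    filter_upwards [h0] with x hx
    have hx' : cosetMeasure x N = 0 := hx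
    rw [← lintegral_indicator_one hN, lintegral_cosetMeasure _ (measurable_one.indicator hN),
      ENNReal.tsum_eq_zero] at hx'
    have h1 := hx' 1
    by_contra hne
    have hmem : repr x * ((1 : AutZ) : Aut) ∈ N := by simpa [N] using hne
    rw [Set.indicator_of_mem hmem] at h1
    exact one_ne_zero h1
  have hkey : ∀ f : XH → ℝ≥0∞, Measurable f → ∫⁻ x, f x ∂μ
      = (ν fundDom / haar fundDom) * ∫⁻ g, tile g * f (XH.mk g) ∂haar := by
    intro f hf
    have hF : Measurable fun g => tile g * f (XH.mk g) :=
      measurable_tile.mul (measurable_comp_mk_iff.2 hf)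
    rw [← smul_eq_mul, ← lintegral_smul_measure, ← huniq]
    rw [Measure.lintegral_bind measurable_cosetMeasure.aemeasurable hF.aemeasurable]
    refine lintegral_congr_ae ?_
    filter_upwards [htile] with x hx
    rw [lintegral_cosetMeasure _ hF]
    simp_rw [mk_mul_coe, mk_repr]
    rw [ENNReal.tsum_mul_right, hx, one_mul]
  -- The constant of proportionality is determined by the total mass `1`.
  have hone := hkey (fun _ => 1) measurable_const
  rw [lintegral_tile_mul] at hone
  simp only [lintegral_const, measure_univ, mul_one, Measure.restrict_apply, MeasurableSet.univ,
    Set.univ_inter, one_mul] at hone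
  rw [hkey f hf]
  congr 1
  exact ENNReal.eq_inv_of_mul_eq_one_left hone.symm

theorem muH_isInvariantProbability : IsInvariantProbability muH := by
  rw [muH, dif_pos exists_invariantProbability]
  exact exists_invariantProbability.choose_spec

/-! ### The nil-theta transform of a plate -/

theorem mem_plate {A : Set (ℝ × ℝ)} {z ε : ℝ} {p : Heis} :
    p ∈ plate A z ε ↔ (p.r, p.s) ∈ A ∧ p.t ∈ Set.Ico z (z + ε) := by
  constructor
  · rintro ⟨q, hq, ht, rfl⟩
    simp only [add_def, zero_add, zero_mul, add_zero, sub_zero]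
    exact ⟨hq, by linarith [ht.1], by linarith [ht.2]⟩
  · rintro ⟨h1, h2⟩
    refine ⟨⟨p.r, p.s, p.t - z⟩, h1, ⟨by linarith [h2.1], by linarith [h2.2]⟩, ?_⟩
    rw [add_def]
    ext <;> simp

theorem smul_intPoint (g : Aut) : g • intPoint 0 1 0 =
    ⟨-ent g 1 0, ent g 0 0, ent g 0 2 * ent g 1 0 - ent g 1 2 * ent g 0 0⟩ := by
  rw [smul_eq]
  ext <;> simp [intPoint]

theorem smul_mem_plate {A : Set (ℝ × ℝ)} {z ε : ℝ} {g : Aut} :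
    g • intPoint 0 1 0 ∈ plate A z ε ↔ g ∈ hitSet A z ε := by
  rw [mem_plate, smul_intPoint]; rfl

/-- Bézout coefficients complete `(k, l)` to a unimodular matrix; the translation `-m (u, v)` then
produces the height `m (u k + v l) = m`. -/
theorem exists_smul_eq_intPoint {k l : ℤ} (m : ℤ) (h : Int.gcd k l = 1) :
    ∃ γ : AutZ, (γ : Aut) • intPoint 0 1 0 = intPoint k l m := by
  rw [← Int.isCoprime_iff_gcd_eq_one] at h
  obtain ⟨u, v, huv⟩ := h
  refine ⟨ofInt l u (-k) v (-m * u) (-m * v) (by linarith), ?_⟩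
  have huv' : (u : ℝ) * k + v * l = 1 := by exact_mod_cast huv
  rw [smul_intPoint, coe_ofInt]
  ext
  · simp [intPoint]
  · simp [intPoint]
  · simp [intPoint]
    linear_combination (m : ℝ) * huv'

theorem colSq_shear (g : Aut) (n j : ℤ) :
    colSq (g * ofInt 1 n 0 1 j 0 (by ring)) = colSq g := by
  simp [colSq, ent_mul, coe_ofInt, ent_two_zero]

/-- A stabilizer element adds multiples `n` and `j` of the first column to the second column and to
the translation, so the two projections onto the first column shift by integers. -/
theorem shear_mem_shearDom {g : Aut} {n j : ℤ} :
    g * ofInt 1 n 0 1 j 0 (by ring) ∈ shearDom ↔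
      (ent g 0 0 * ent g 0 1 + ent g 1 0 * ent g 1 1) / colSq g + n ∈ Set.Ico (0 : ℝ) 1 ∧
      (ent g 0 0 * ent g 0 2 + ent g 1 0 * ent g 1 2) / colSq g + j ∈ Set.Ico (0 : ℝ) 1 := by
  have hN := (colSq_pos g).ne'
  have e : ∀ (p q s : ℝ), (ent g 0 0 * (ent g 0 0 * s + p) + ent g 1 0 * (ent g 1 0 * s + q)) /
      colSq g = (ent g 0 0 * p + ent g 1 0 * q) / colSq g + s := by
    intro p q s
    rw [div_add' _ _ _ hN]
    congr 1
    unfold colSq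
    ring
  simp only [shearDom, Set.mem_ofPred_eq, colSq_shear, ← e]
  simp [ent_mul, coe_ofInt, ent_two_zero, ent_two_one, ent_two_two]

/-- Orbit and stabilizer: `γ` is determined by the point up to the stabilizer of `(0, 1, 0)`, and
`shearDom` contains exactly one representative of each class. -/
theorem bijective_orbit (g : Aut) : Function.Bijective
    (fun γ : {γ : AutZ | g * γ ∈ shearDom} => (⟨(g * γ.1) • intPoint 0 1 0, by
      rw [primitivePoints_mk, mul_smul]
      obtain ⟨k, l, m, h, e⟩ := AutZ_smul_prim γ.1.2 0 1 0 (by simp)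
      exact ⟨k, l, m, h, by rw [e]⟩⟩ : primitivePoints (XH.mk g))) := by
  constructor
  · rintro ⟨γ, hγ⟩ ⟨γ', hγ'⟩ h
    have h : (g * γ) • intPoint 0 1 0 = (g * γ') • intPoint 0 1 0 := congrArg Subtype.val h
    apply Subtype.ext
    obtain ⟨δ, rfl⟩ : ∃ δ : AutZ, γ' = γ * δ := ⟨γ⁻¹ * γ', by simp⟩
    have hδ : (δ : Aut) • intPoint 0 1 0 = intPoint 0 1 0 := by
      rw [Subgroup.coe_mul, ← mul_assoc, mul_smul _ (δ : Aut)] at h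
      exact (MulAction.injective (g * (γ : Aut)) h).symm
    obtain ⟨a, b, c, d, x, y, hd, rfl⟩ := exists_eq_ofInt δ
    rw [smul_intPoint, coe_ofInt] at hδ
    have h1 := congrArg Heis.r hδ
    have h2 := congrArg Heis.s hδ
    have h3 := congrArg Heis.t hδ
    simp [intPoint] at h1 h2 h3
    subst h1 h2
    have hy : y = 0 := by
      have : (y : ℝ) = 0 := by push_cast at h3; linarith
      exact_mod_cast this
    have hd1 : d = 1 := by linarith
    subst hy hd1
    have hγ₂ : g * γ * ofInt 1 b 0 1 x 0 hd ∈ shearDom := by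
      have := hγ'
      simpa [mul_assoc] using this
    rw [shear_mem_shearDom] at hγ₂
    have hb := eq_of_floor_zero hγ.1 hγ₂.1
    have hx := eq_of_floor_zero hγ.2 hγ₂.2
    subst hb hx
    have : ofInt 1 0 0 1 0 0 hd = 1 := by
      apply Subtype.ext
      rw [coe_ofInt]
      apply ent_ext <;> simp [ent_one]
    change γ = γ * _
    rw [this, mul_one]
  · rintro ⟨p, hp⟩
    have hp' := hp
    rw [primitivePoints_mk] at hp'
    obtain ⟨k, l, m, h, e⟩ := hp'
    obtain ⟨γ, hγ⟩ := exists_smul_eq_intPoint m h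
    let s := (ent (g * γ) 0 0 * ent (g * γ) 0 1 + ent (g * γ) 1 0 * ent (g * γ) 1 1) / colSq (g * γ)
    let t := (ent (g * γ) 0 0 * ent (g * γ) 0 2 + ent (g * γ) 1 0 * ent (g * γ) 1 2) / colSq (g * γ)
    have hmem : g * γ * ofInt 1 (-⌊s⌋) 0 1 (-⌊t⌋) 0 (by ring) ∈ shearDom := by
      rw [shear_mem_shearDom]
      have hs := Int.fract_nonneg s
      have hs' := Int.fract_lt_one s
      have ht := Int.fract_nonneg t
      have ht' := Int.fract_lt_one t
      rw [Int.fract] at hs hs' ht ht'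
      push_cast
      exact ⟨⟨by linarith, by linarith⟩, by linarith, by linarith⟩
    refine ⟨⟨γ * ofInt 1 (-⌊s⌋) 0 1 (-⌊t⌋) 0 (by ring), ?_⟩, Subtype.ext ?_⟩
    · simpa [mul_assoc] using hmem
    · change (g * ((γ * ofInt 1 (-⌊s⌋) 0 1 (-⌊t⌋) 0 (by ring) : AutZ) : Aut)) • intPoint 0 1 0 = p
      have hfix : (ofInt 1 (-⌊s⌋) 0 1 (-⌊t⌋) 0 (by ring) : Aut) • intPoint 0 1 0
          = intPoint 0 1 0 := by
        rw [smul_intPoint, coe_ofInt]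
        ext <;> simp [intPoint]
      rw [e, Subgroup.coe_mul, mul_smul, mul_smul, hfix, hγ]

theorem nilTheta_plate_mk (A : Set (ℝ × ℝ)) (z ε : ℝ) (g : Aut) :
    nilTheta ((plate A z ε).indicator (fun _ => (1 : ℝ≥0∞))) (XH.mk g) =
      ∑' γ : AutZ, (hitSet A z ε ∩ shearDom).indicator 1 (g * γ) := by
  rw [nilTheta, ← (Equiv.ofBijective _ (bijective_orbit g)).tsum_eq]
  simp only [Equiv.ofBijective_apply]
  rw [tsum_subtype {γ : AutZ | g * γ ∈ shearDom} (fun γ : AutZ =>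
    (plate A z ε).indicator (fun _ => (1 : ℝ≥0∞)) ((g * γ) • intPoint 0 1 0))]
  refine tsum_congr fun γ => ?_
  classical
  simp only [Set.indicator_apply, Set.mem_inter_iff, Set.mem_ofPred_eq, smul_mem_plate,
    Pi.one_apply]
  split_ifs <;> first | rfl | tauto

theorem measurable_nilTheta_plate {A : Set (ℝ × ℝ)} (hA : MeasurableSet A) (z ε : ℝ) :
    Measurable (nilTheta ((plate A z ε).indicator (fun _ => (1 : ℝ≥0∞)))) := by
  refine measurable_comp_mk_iff.1 ?_
  simp_rw [nilTheta_plate_mk]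
  exact measurable_tsum_mul
    (measurable_one.indicator ((measurableSet_hitSet hA z ε).inter measurableSet_shearDom))

/-! ### The mean value for Borel and for null-measurable bases -/

theorem riemannZeta_two_re : (riemannZeta 2).re = Real.pi ^ 2 / 6 := by
  rw [riemannZeta_two]
  norm_cast

theorem lintegral_nilTheta_plate_of_measurableSet {A : Set (ℝ × ℝ)} (hA : MeasurableSet A)
    (z ε : ℝ) (hε : 0 < ε) :
    ∫⁻ L, nilTheta ((plate A z ε).indicator (fun _ => (1 : ℝ≥0∞))) L ∂muH =
      volume A * ENNReal.ofReal ε / ENNReal.ofReal (riemannZeta 2).re := by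
  have hm := (measurableSet_hitSet hA z ε).inter measurableSet_shearDom
  rw [lintegral_of_invariant muH_isInvariantProbability (measurable_nilTheta_plate hA z ε)]
  simp_rw [nilTheta_plate_mk]
  -- Unfolding leaves a quotient of two volumes, `(m(A) ε / 3) / (π² / 18)`.
  rw [← lintegral_unfold measurable_tile tsum_tile (measurable_one.indicator hm),
    lintegral_indicator_one hm, haar_hitSet hA z ε hε, haar_fundDom, riemannZeta_two_re,
    ENNReal.div_eq_inv_mul, mul_left_comm, mul_left_comm _ (volume A),
    ← ENNReal.ofReal_inv_of_pos (by positivity), ← ENNReal.ofReal_inv_of_pos (by positivity),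
    ← ENNReal.ofReal_mul (by positivity), ← ENNReal.ofReal_mul (by positivity)]
  congr 2
  field_simp
  norm_num

/-- `B` is a Borel superset of `A` with null difference. The mean value formula for a Borel null set
`N ⊇ B \ A` is zero, so almost every lattice has no primitive point in the plate over `N`, and for
it the two sums agree term by term. -/
theorem exists_measurableSet_nilTheta_plate_ae_eq {A : Set (ℝ × ℝ)}
    (hA : NullMeasurableSet A volume) (z ε : ℝ) (hε : 0 < ε) :
    ∃ B : Set (ℝ × ℝ), MeasurableSet B ∧ volume B = volume A ∧
      nilTheta ((plate A z ε).indicator (fun _ => (1 : ℝ≥0∞))) =ᵐ[muH]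
        nilTheta ((plate B z ε).indicator (fun _ => (1 : ℝ≥0∞))) := by
  obtain ⟨B, hAB, hB, hae⟩ := hA.exists_measurable_superset_ae_eq
  refine ⟨B, hB, measure_congr hae, ?_⟩
  let N := toMeasurable volume (B \ A)
  have hN : volume N = 0 := by
    rw [measure_toMeasurable]
    exact (ae_le_set.1 hae.le)
  have h0 := lintegral_nilTheta_plate_of_measurableSet (measurableSet_toMeasurable volume (B \ A))
    z ε hε
  rw [show volume (toMeasurable volume (B \ A)) = 0 from hN, zero_mul, ENNReal.zero_div,
    lintegral_eq_zero_iff (measurable_nilTheta_plate (measurableSet_toMeasurable _ _) z ε)] at h0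
  filter_upwards [h0] with L hL
  have hL' : ∀ p : primitivePoints L,
      (plate N z ε).indicator (fun _ => (1 : ℝ≥0∞)) p = 0 := ENNReal.tsum_eq_zero.1 hL
  refine tsum_congr fun p => ?_
  have hp : (p : Heis) ∉ plate N z ε := by
    intro h
    have := hL' p
    rw [Set.indicator_of_mem h] at this
    exact one_ne_zero this
  have hiff : (p : Heis) ∈ plate A z ε ↔ (p : Heis) ∈ plate B z ε := by
    rw [mem_plate] at hp
    rw [mem_plate, mem_plate]
    refine ⟨fun h => ⟨hAB h.1, h.2⟩, fun h => ⟨?_, h.2⟩⟩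
    by_contra hn
    exact hp ⟨subset_toMeasurable volume (B \ A) ⟨h.1, hn⟩, h.2⟩
  by_cases h : (p : Heis) ∈ plate A z ε
  · rw [Set.indicator_of_mem h, Set.indicator_of_mem (hiff.1 h)]
  · rw [Set.indicator_of_notMem h, Set.indicator_of_notMem (mt hiff.2 h)]

theorem toReal_indicator_one (S : Set Heis) (p : Heis) :
    (S.indicator (fun _ => (1 : ℝ≥0∞)) p).toReal = S.indicator (fun _ => (1 : ℝ)) p := by
  by_cases h : p ∈ S <;> simp [h]

/-- No summability is needed: for a divergent sum both sides take the default value `0`. -/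
theorem nilTheta_real_eq (S : Set Heis) (L : XH) :
    nilTheta (S.indicator (fun _ => (1 : ℝ))) L =
      (nilTheta (S.indicator (fun _ => (1 : ℝ≥0∞))) L).toReal := by
  rw [nilTheta, nilTheta, ENNReal.tsum_toReal_eq]
  · exact tsum_congr fun p => (toReal_indicator_one S p).symm
  · intro p
    by_cases h : (p : Heis) ∈ S <;> simp [h]

end HeisenbergLattice

end

theorem mainTheorem6 (A : Set (ℝ × ℝ)) (hA : NullMeasurableSet A volume) (hpos : 0 < volume A)
    (z ε : ℝ) (hε0 : 0 < ε) (hε1 : ε < 1) :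
    (AEMeasurable (nilTheta ((plate A z ε).indicator (fun _ => (1 : ℝ≥0∞)))) muH ∧
      ∫⁻ L, nilTheta ((plate A z ε).indicator (fun _ => (1 : ℝ≥0∞))) L ∂muH =
        volume A * ENNReal.ofReal ε / ENNReal.ofReal (riemannZeta 2).re) ∧
    (volume A < ⊤ →
      (∀ᵐ L ∂muH, Summable
        (fun p : primitivePoints L => (plate A z ε).indicator (fun _ => (1 : ℝ)) p)) ∧
      Integrable (nilTheta ((plate A z ε).indicator (fun _ => (1 : ℝ)))) muH ∧
      ∫ L, |nilTheta ((plate A z ε).indicator (fun _ => (1 : ℝ))) L| ∂muH =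
        (volume A).toReal * ε / (riemannZeta 2).re) := by
  obtain ⟨B, hB, hvol, hae⟩ := exists_measurableSet_nilTheta_plate_ae_eq hA z ε hε0
  have hm : AEMeasurable (nilTheta ((plate A z ε).indicator (fun _ => (1 : ℝ≥0∞)))) muH :=
    ⟨_, measurable_nilTheta_plate hB z ε, hae⟩
  have hint : ∫⁻ L, nilTheta ((plate A z ε).indicator (fun _ => (1 : ℝ≥0∞))) L ∂muH =
      volume A * ENNReal.ofReal ε / ENNReal.ofReal (riemannZeta 2).re := by
    rw [lintegral_congr_ae hae, lintegral_nilTheta_plate_of_measurableSet hB z ε hε0, hvol]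
  have hz : 0 < (riemannZeta 2).re := by rw [riemannZeta_two_re]; positivity
  refine ⟨⟨hm, hint⟩, fun hfin => ?_⟩
  have hne : ∫⁻ L, nilTheta ((plate A z ε).indicator (fun _ => (1 : ℝ≥0∞))) L ∂muH ≠ ⊤ := by
    rw [hint]
    exact ENNReal.div_ne_top (ENNReal.mul_ne_top hfin.ne ENNReal.ofReal_ne_top)
      (ENNReal.ofReal_pos.2 hz).ne'
  have hlt := ae_lt_top' hm hne
  have heq : nilTheta ((plate A z ε).indicator (fun _ => (1 : ℝ))) =
      fun L => (nilTheta ((plate A z ε).indicator (fun _ => (1 : ℝ≥0∞))) L).toReal :=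
    funext fun L => nilTheta_real_eq _ L
  refine ⟨?_, ?_, ?_⟩
  · filter_upwards [hlt] with L hL
    have := ENNReal.summable_toReal (f := fun p : primitivePoints L =>
      (plate A z ε).indicator (fun _ => (1 : ℝ≥0∞)) p) hL.ne
    simpa only [toReal_indicator_one] using this
  · rw [heq]
    exact integrable_toReal_of_lintegral_ne_top hm hne
  · rw [heq]
    simp only [abs_of_nonneg ENNReal.toReal_nonneg]
    rw [integral_toReal hm hlt, hint, ENNReal.toReal_div, ENNReal.toReal_mul,
      ENNReal.toReal_ofReal hε0.le, ENNReal.toReal_ofReal hz.le]
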